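/- A flow $(X,T)$ is a compact Hausdorff space $X$ with a homeomorphism $T:X\to X$. It is minimal if every orbit $\{T^nx:n\in\mathbb Z\}$ is dense; distal if for all $x\ne y$ there is a neighbourhood $V$ of the diagonal of $X\times X$ with $(T^nx,T^ny)\notin V$ for all $n\in\mathbb Z$; uniquely ergodic if it has exactly one invariant (regular) Borel probability measure; strictly ergodic if it is minimal and uniquely ergodic. A function $u\in\ell^\infty(\mathbb Z)$ (complex valued) comes from $(X,T)$ if $u(n)=F(T^nx_0)$ $(n\in\mathbb Z)$ for some $F\in C(X)$ and $x_0\in X$. Let $\mathcal D$ be the set of functions coming from minimal distal flows, $\mathcal S$ the set of functions coming from strictly ergodic flows, and $\mathcal S^d=\mathcal D\cap\mathcal S$. Let $\mathcal W$ (the Weyl algebra) be the smallest closed translation-invariant subalgebra of $\ell^\infty(\mathbb Z)$ containing all functions $n\mapsto e^{2\pi i n^k\alpha}$, $\alpha\in\mathbb R$, $k\in\mathbb N$. Then: (1) $\mathcal S^d$ is not closed under subtraction: there are $u,w\in\mathcal S^d$ with $u-w\notin\mathcal S$. Hence $\mathcal S^d$ is not a subalgebra, and not even a vector subspace, of $\ell^\infty(\mathbb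 Z)$. (2) $\mathcal W\subsetneq\mathcal S^d$. (3) Let $v_1=1$, $v_{k+1}=2^{v_k}+v_k+1$, $n_k=2^{v_k}$, $n_{-k}=-n_k$ $(k\ge1)$ and $\alpha=\sum_{k\ge1}n_k^{-1}$. There is $t\in[0,1]$ such that the series $$h(x)=t\sum_{k\ne0}(e^{2\pi i n_k\alpha}-1)e^{2\pi i n_kx},\qquad g(x)=t\sum_{k\ne0}(e^{2\pi i n_k\alpha}-1)\Bigl(1+\frac1{|k|}\Bigr)e^{2\pi i n_kx},$$ $$f(x)=g(x)-h(x)=t\sum_{k\ne0}\frac1{|k|}(e^{2\pi i n_k\alpha}-1)e^{2\pi i n_kx}$$ converge to continuous real-valued functions on $\mathbb T=\mathbb R/\mathbb Z$ with the following properties. For continuous $\varphi:\mathbb T\to\mathbb R$ put $T_\varphi(x,y)=(x+\alpha,\,y+\varphi(x))$ on $\mathbb T^2$ and let $E_\varphi(n)=e^{2\pi i y_n}$, where $(x_n,y_n)=T_\varphi^n(0,0)$, $n\in\mathbb Z$. The flows $(\mathbb T^2,T_h)$ and $(\mathbb T^2,T_g)$ are distal and strictly ergodic, whereas $(\mathbb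 T^2,T_f)$ is distal and minimal but not uniquely ergodic. Moreover $E_h,E_g\in\mathcal S^d$, while $E_f\in\mathcal D\setminus\mathcal S$ and $E_g-E_h\notin\mathcal S$. -/

import Mathlib

open scoped Topology ENNReal lp

noncomputable section

namespace ZFlow

/-! ### Flows: a self-homeomorphism `T` of a compact Hausdorff space `X` -/

section Flows

variable {X : Type*} [TopologicalSpace X]

/-- Every two-sided orbit is dense. -/
def IsMinimal (T : X ≃ₜ X) : Prop :=
  ∀ x : X, Dense (Set.range fun n : ℤ => (T ^ n) x)

/-- Distality: for every pair `x ≠ y` there is a neighbourhood of the diagonal that the orbit of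
`(x, y)` under `T × T` avoids.  On a compact metric space this says
`inf_n d(T^n x, T^n y) > 0`. -/
def IsDistal (T : X ≃ₜ X) : Prop :=
  ∀ x y : X, x ≠ y → ∃ V ∈ 𝓝ˢ (Set.diagonal X), ∀ n : ℤ, ((T ^ n) x, (T ^ n) y) ∉ V

/-- There is exactly one invariant (regular) Borel probability measure.  Regularity is automatic
when `X` is compact metrizable. -/
def IsUniquelyErgodic [MeasurableSpace X] (T : X ≃ₜ X) : Prop :=
  ∃! μ : MeasureTheory.Measure X,
    MeasureTheory.IsProbabilityMeasure μ ∧ μ.Regular ∧ MeasureTheory.MeasurePreserving T μ μ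

/-- Strict ergodicity: minimality and unique ergodicity. -/
def IsStrictlyErgodic [MeasurableSpace X] (T : X ≃ₜ X) : Prop :=
  IsMinimal T ∧ IsUniquelyErgodic T

end Flows

/-! ### Families of functions in `ℓ^∞(ℤ)` -/

/-- `f` comes from the flow `(X, T)`: `f n = F (T ^ n x₀)` for some continuous `F` and point
`x₀`. -/
def ComesFrom {X : Type*} [TopologicalSpace X] (f : ℓ^∞(ℤ, ℂ)) (T : X ≃ₜ X) : Prop :=
  ∃ (F : C(X, ℂ)) (x₀ : X), ∀ n : ℤ, f n = F ((T ^ n) x₀)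

/-- The family `𝒟` of distal functions: those coming from a minimal distal flow.
Quantifying over `X : Type` loses nothing, since a function coming from any flow also comes from
the closure of its own translates in `ℤ → ℂ`, which is a factor of the orbit closure. -/
def distalFunctions : Set ℓ^∞(ℤ, ℂ) :=
  {f | ∃ (X : Type) (_ : TopologicalSpace X) (_ : CompactSpace X) (_ : T2Space X) (T : X ≃ₜ X),
    IsMinimal T ∧ IsDistal T ∧ ComesFrom f T}

/-- The family `𝒮` of strictly ergodic functions: those coming from a strictly ergodic flow. -/
def strictlyErgodicFunctions : Set ℓ^∞(ℤ, ℂ) :=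
  {f | ∃ (X : Type) (_ : TopologicalSpace X) (_ : CompactSpace X) (_ : T2Space X)
    (_ : MeasurableSpace X) (_ : BorelSpace X) (T : X ≃ₜ X),
    IsStrictlyErgodic T ∧ ComesFrom f T}

/-- The family `𝒮^d` of strictly ergodic functions in `𝒟`. -/
def strictlyErgodicDistalFunctions : Set ℓ^∞(ℤ, ℂ) :=
  distalFunctions ∩ strictlyErgodicFunctions

/-! ### The Weyl algebra -/

/-- The function `n ↦ exp(2πi n^k α)`. -/
def weylFunction (α : ℝ) (k : ℕ) : ℓ^∞(ℤ, ℂ) :=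
  ⟨fun n => Complex.exp ((2 * Real.pi * ((n : ℝ) ^ k * α) : ℝ) * Complex.I),
    memℓp_infty ⟨1, by
      rintro _ ⟨n, rfl⟩
      exact (Complex.norm_exp_ofReal_mul_I _).le⟩⟩

/-- The translate `n ↦ f (n + m)` of `f`. -/
def translate (m : ℤ) (f : ℓ^∞(ℤ, ℂ)) : ℓ^∞(ℤ, ℂ) :=
  ⟨fun n => f (n + m), memℓp_infty ⟨‖f‖, by
    rintro _ ⟨n, rfl⟩
    exact lp.norm_apply_le_norm ENNReal.top_ne_zero f (n + m)⟩⟩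

/-- The Weyl algebra `𝒲`: the smallest closed translation-invariant subalgebra of `ℓ^∞(ℤ)` that
contains all functions `n ↦ exp(2πi n^k α)`. -/
def weylAlgebra : Subalgebra ℂ ℓ^∞(ℤ, ℂ) :=
  sInf {A | IsClosed (A : Set ℓ^∞(ℤ, ℂ)) ∧ (∀ m : ℤ, ∀ f ∈ A, translate m f ∈ A) ∧
    ∀ (α : ℝ) (k : ℕ), weylFunction α k ∈ A}

/-! ### Skew products over a rotation of the circle `𝕋 = ℝ/ℤ` -/

/-- The homeomorphism `(x, y) ↦ (x + α, y + φ x)` of `𝕋²`, for a continuous `φ : 𝕋 → ℝ`. -/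
def skewProduct (α : ℝ) (φ : C(UnitAddCircle, ℝ)) :
    UnitAddCircle × UnitAddCircle ≃ₜ UnitAddCircle × UnitAddCircle where
  toFun p := (p.1 + (α : UnitAddCircle), p.2 + (φ p.1 : UnitAddCircle))
  invFun p := (p.1 - (α : UnitAddCircle), p.2 - (φ (p.1 - (α : UnitAddCircle)) : UnitAddCircle))
  left_inv p := by simp
  right_inv p := by simp
  continuous_toFun := by
    have h : Continuous fun r : ℝ => (r : UnitAddCircle) := AddCircle.continuous_mk' 1
    exact (continuous_fst.add continuous_const).prodMk
      (continuous_snd.add (h.comp (φ.continuous.comp continuous_fst)))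
  continuous_invFun := by
    have h : Continuous fun r : ℝ => (r : UnitAddCircle) := AddCircle.continuous_mk' 1
    exact (continuous_fst.sub continuous_const).prodMk
      (continuous_snd.sub (h.comp (φ.continuous.comp (continuous_fst.sub continuous_const))))

/-- The function `n ↦ exp(2πi yₙ)`, where `(xₙ, yₙ) = Tⁿ(0, 0)` for the skew product `T` of `α` and
`φ`; thus `yₙ = φ(0) + φ(α) + ⋯ + φ((n - 1)α)` for `n ≥ 0`. -/
def skewFunction (α : ℝ) (φ : C(UnitAddCircle, ℝ)) : ℓ^∞(ℤ, ℂ) :=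
  ⟨fun n => (AddCircle.toCircle ((skewProduct α φ ^ n) (0, 0)).2 : ℂ),
    memℓp_infty ⟨1, by
      rintro _ ⟨n, rfl⟩
      exact (Circle.norm_coe _).le⟩⟩

/-! ### Furstenberg's sequences -/

/-- `v 1 = 1`, `v (k + 1) = 2 ^ v k + v k + 1` for `k ≥ 1` (the value at `0` is not used). -/
def furstenbergV : ℕ → ℕ
  | 0 => 0
  | 1 => 1
  | k + 2 => 2 ^ furstenbergV (k + 1) + furstenbergV (k + 1) + 1

/-- `n k = 2 ^ v k` and `n (-k) = -n k` for `k ≥ 1` (the value at `0` is not used). -/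
def furstenbergN (k : ℤ) : ℤ := k.sign * 2 ^ furstenbergV k.natAbs

/-- `α = ∑_{k ≥ 1} 1 / n k`. -/
def furstenbergAlpha : ℝ := ∑' k : ℕ, (1 : ℝ) / furstenbergN ((k : ℤ) + 1)

/-- The real-valued continuous function `φ` on `𝕋` is the sum of the series
`t ∑_{k ≠ 0} (exp(2πi n_k α) - 1) c_k exp(2πi n_k x)`. -/
def HasFurstenbergSeries (t : ℝ) (c : ℤ → ℝ) (φ : C(UnitAddCircle, ℝ)) : Prop :=
  ∀ x : UnitAddCircle,
    HasSum (fun k : {k : ℤ // k ≠ 0} =>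
      (t : ℂ) * ((fourier (furstenbergN k) (furstenbergAlpha : UnitAddCircle) - 1) * (c k : ℂ) *
        fourier (furstenbergN k) x)) (φ x : ℂ)

end ZFlow

end

open scoped ENNReal lp

open scoped Topology

namespace ZFlow

open MeasureTheory Filter Set

/-! ### Invariant measures as limits of orbital averages -/

section KrylovBogoliubov

variable {X : Type*} [TopologicalSpace X]

/-! Everything rests on the identity `1 - |E_g - E_h|² / 2 = Re (E_g · conj E_h) = Re E_f` with `f =
g - h`. If `E_g - E_h` came from a uniquely ergodic flow, `Re E_f` would be read off the same flow
by a continuous function, so its averages over long orbit segments could not accumulate at two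
values. But `T_f` is minimal and has two invariant measures that integrate `cos 2πy` differently,
and minimality makes the orbit of `(0, 0)` see both values
(`not_isUniquelyErgodic_of_two_integrals`).

The three cocycles have the form `t ∑ c_k (e(n_k α) - 1) e(n_k x)` plus its conjugate, where `e(x) =
exp(2πix)`; formally this is the coboundary of `t ∑ c_k e(n_k x)` plus its conjugate. The arithmetic
of `α` gives times `∑_{K ≤ j ≤ L} 2^{n_j}` that nearly return the rotation to its start while `e(n_k
·)` is multiplied by about `-1` for `K ≤ k ≤ L` and by about `1` otherwise. The orbital sum at such
a time is therefore close to `-4t ∑_{K ≤ k ≤ L} c_k cos(2π n_k x)`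
(`abs_rotationSum_cocycle_add_le`).

If `c_k → 1` (the cases `h` and `g`), take `K = L`. A Fourier coefficient `I` of an invariant
measure at a character with nonzero vertical frequency is nearly unchanged when the character is
multiplied by a fixed nonconstant unimodular function of `n_K x`. As `n_K → ∞` this factor
decouples, so `I` equals itself times a number other than `1`, and `I = 0`. Haar measure is thus the
only invariant measure; it has full support, so the flow is minimal.

If `c_k = 1/k` (the case `f`), divergence of `∑ c_k` together with `c_k → 0` lets the sums over `x =
0` approximate every value modulo `1`, whence minimality. Convergence of `∑ c_k²` makes `f` the
coboundary of some `tΘ` with `Θ` integrable, so the graph of `tΘ` and its vertical shift by `1/2`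
carry invariant measures. The shift changes the sign of the integral of `cos 2πy`, and that integral
is positive for small `t`.

For the Weyl algebra, one flow suffices: the orbit closure of the family of all sequences `n^k α`.
It consists of polynomial sequences, hence is distal; it is uniquely ergodic by Weyl's theorem; the
functions read off at its base point form a closed invariant algebra containing the generators. The
inclusion is strict because an algebra containing `E_g` and `E_h` contains their difference. -/

theorem pow_apply_eq_iterate (T : X ≃ₜ X) (n : ℕ) (x : X) : (T ^ n) x = T^[n] x := by
  induction n generalizing x with
  | zero => rfl
  | succ n ih =>
    rw [pow_succ, Function.iterate_succ_apply, ← ih]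
    rfl

theorem zpow_natCast_apply_eq_iterate (T : X ≃ₜ X) (n : ℕ) (x : X) :
    (T ^ (n : ℤ)) x = T^[n] x := by
  rw [zpow_natCast, pow_apply_eq_iterate]

theorem zpow_add_apply (T : X ≃ₜ X) (m n : ℤ) (x : X) :
    (T ^ (m + n)) x = (T ^ m) ((T ^ n) x) := by
  rw [zpow_add]
  rfl

variable [MeasurableSpace X]

/-- The uniform probability measure on the orbit segment `x, T x, …, T ^ N x`. -/
noncomputable def empiricalMeasure (T : X → X) (N : ℕ) (x : X) : Measure X :=
  ((N + 1 : ℝ≥0∞)⁻¹) • ∑ k ∈ Finset.range (N + 1), Measure.dirac (T^[k] x)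

instance (T : X → X) (N : ℕ) (x : X) : IsProbabilityMeasure (empiricalMeasure T N x) := by
  constructor
  simp only [empiricalMeasure, Measure.smul_apply, Measure.coe_finsetSum, Finset.sum_apply,
    measure_univ, Finset.sum_const, Finset.card_range, nsmul_eq_mul, mul_one, smul_eq_mul]
  push_cast
  exact ENNReal.inv_mul_cancel (by positivity) (by finiteness)

omit [TopologicalSpace X] in
theorem integral_empiricalMeasure [MeasurableSingletonClass X] (T : X → X) (N : ℕ) (x : X)
    (G : X → ℝ) : ∫ y, G y ∂(empiricalMeasure T N x) = birkhoffAverage ℝ T G (N + 1) x := by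
  rw [empiricalMeasure, integral_smul_measure, integral_finsetSum_measure]
  · simp only [integral_dirac, birkhoffAverage, birkhoffSum]
    congr 1
    rw [ENNReal.toReal_inv, ENNReal.toReal_add (by finiteness) (by finiteness)]
    simp
  · intro i _
    exact integrable_dirac enorm_lt_top

variable [CompactSpace X] [T2Space X] [BorelSpace X]

theorem map_eq_self_of_integral_comp_eq (T : X ≃ₜ X) (μ : Measure X) [μ.Regular]
    [IsFiniteMeasure μ] (h : ∀ G : C(X, ℝ), ∫ x, G (T x) ∂μ = ∫ x, G x ∂μ) :
    MeasurePreserving T μ μ := by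
  refine ⟨T.continuous.measurable, ?_⟩
  have : (μ.map T).Regular := Measure.Regular.map T
  refine Measure.ext_of_integral_eq_on_compactlySupported fun G => ?_
  rw [integral_map (φ := T) (f := G) T.continuous.aemeasurable
    (G.continuous.stronglyMeasurable_of_hasCompactSupport G.hasCompactSupport).aestronglyMeasurable]
  exact h G.toContinuousMap

/-- Any sequence of points gives rise to an invariant measure whose integrals are limit points of
the averages along the orbit segments starting at these points. -/
theorem exists_invariant_measure_of_averages (T : X ≃ₜ X) (x : ℕ → X) :
    ∃ μ : Measure X, (IsProbabilityMeasure μ ∧ μ.Regular ∧ MeasurePreserving T μ μ) ∧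
      ∀ (G : C(X, ℝ)) (c : ℝ), (∀ᶠ N in atTop, c ≤ birkhoffAverage ℝ T G (N + 1) (x N)) →
        c ≤ ∫ y, G y ∂μ := by
  let m : ℕ → ProbabilityMeasure X := fun N => ⟨empiricalMeasure T N (x N), inferInstance⟩
  -- An ultrafilter limit replaces a convergent subsequence, because `X` need not be metrizable.
  let 𝒰 : Ultrafilter (ProbabilityMeasure X) := (hyperfilter ℕ).map m
  obtain ⟨ν, -, hν⟩ := isCompact_univ.ultrafilter_le_nhds 𝒰 (by simp)
  have hν' : Tendsto m (hyperfilter ℕ) (𝓝 ν) := hν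
  rw [ProbabilityMeasure.tendsto_iff_forall_integral_tendsto] at hν'
  -- The limit itself may fail to be regular; a regular measure with the same integrals of
  -- continuous functions takes its place.
  obtain ⟨μ, hreg, hfin, hμ⟩ := Measure.exists_regular_eq_of_compactSpace (ν : Measure X)
  have hlim : ∀ G : C(X, ℝ), Tendsto (fun N => birkhoffAverage ℝ T G (N + 1) (x N))
      (hyperfilter ℕ) (𝓝 (∫ y, G y ∂μ)) := by
    intro G
    have h1 := hν' (BoundedContinuousFunction.mkOfCompact G)
    rw [hμ] at h1
    refine h1.congr fun N => ?_
    exact integral_empiricalMeasure T N (x N) G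
  have hprob : IsProbabilityMeasure μ := by
    have h1 := hμ 1
    simp only [BoundedContinuousFunction.coe_one, Pi.one_apply, integral_const, smul_eq_mul,
      mul_one, probReal_univ] at h1
    exact ⟨by rw [← ENNReal.toReal_eq_one_iff]; exact h1.symm⟩
  refine ⟨μ, ⟨hprob, hreg, map_eq_self_of_integral_comp_eq T μ fun G => ?_⟩, fun G c hc => ?_⟩
  · have h1 := (hlim (G.comp ⟨T, T.continuous⟩)).sub (hlim G)
    -- The two averages differ only in end terms, by at most `2‖G‖ / (N + 1)`, whatever the starting
    -- points are.
    have h2 : Tendsto (fun N : ℕ => birkhoffAverage ℝ T (G.comp ⟨T, T.continuous⟩) (N + 1) (x N) -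
        birkhoffAverage ℝ T G (N + 1) (x N)) (hyperfilter ℕ) (𝓝 0) := by
      have h3 : Tendsto (fun N : ℕ => (2 * ‖G‖) * ((N : ℝ) + 1)⁻¹) (hyperfilter ℕ) (𝓝 0) := by
        have := (tendsto_one_div_add_atTop_nhds_zero_nat (𝕜 := ℝ)).const_mul (2 * ‖G‖)
        simp only [mul_zero, one_div] at this
        exact this.mono_left Nat.hyperfilter_le_atTop
      refine squeeze_zero_norm (fun N => ?_) h3
      have h4 : birkhoffAverage ℝ T (G.comp ⟨T, T.continuous⟩) (N + 1) (x N) =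
          birkhoffAverage ℝ T G (N + 1) (T (x N)) := by
        simp only [birkhoffAverage, birkhoffSum, ContinuousMap.comp_apply, ContinuousMap.coe_mk,
          ← Function.iterate_succ_apply, ← Function.iterate_succ_apply']
      rw [h4, birkhoffAverage_apply_sub_birkhoffAverage, norm_smul, mul_comm]
      gcongr
      · calc ‖G (T^[N + 1] (x N)) - G (x N)‖ ≤ ‖G (T^[N + 1] (x N))‖ + ‖G (x N)‖ := norm_sub_le _ _
          _ ≤ ‖G‖ + ‖G‖ := add_le_add (G.norm_coe_le_norm _) (G.norm_coe_le_norm _)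
          _ = 2 * ‖G‖ := by ring
      · rw [norm_inv, Real.norm_of_nonneg (by positivity)]
        push_cast
        rfl
    have h5 := tendsto_nhds_unique h1 h2
    exact sub_eq_zero.mp h5
  · exact ge_of_tendsto (hlim G) (Nat.hyperfilter_le_atTop hc)

/-- In a uniquely ergodic flow the averages of a continuous function along orbit segments cannot
have two different limits. -/
theorem IsUniquelyErgodic.le_of_averages {T : X ≃ₜ X} (hT : IsUniquelyErgodic T) (G : C(X, ℝ))
    (x y : ℕ → X) (c d : ℝ)
    (hx : ∀ N, c ≤ birkhoffAverage ℝ T G (N + 1) (x N))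
    (hy : ∀ N, birkhoffAverage ℝ T G (N + 1) (y N) ≤ d) : c ≤ d := by
  obtain ⟨μ, hμ, hc⟩ := exists_invariant_measure_of_averages T x
  obtain ⟨ν, hν, hd⟩ := exists_invariant_measure_of_averages T y
  have h1 := hc G c (.of_forall hx)
  have h2 := hd (-G) (-d) <| .of_forall fun N => by
    have : birkhoffAverage ℝ T (-G : C(X, ℝ)) (N + 1) (y N) =
        -birkhoffAverage ℝ T G (N + 1) (y N) := by
      rw [ContinuousMap.coe_neg, birkhoffAverage_neg]
      rfl
    rw [this]
    exact neg_le_neg (hy N)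
  simp only [ContinuousMap.coe_neg, Pi.neg_apply, integral_neg, neg_le_neg_iff] at h2
  rw [hT.unique hν hμ] at h2
  exact h1.trans h2

theorem exists_invariant_measure [Nonempty X] (T : X ≃ₜ X) :
    ∃ μ : Measure X, IsProbabilityMeasure μ ∧ μ.Regular ∧ MeasurePreserving T μ μ := by
  obtain ⟨μ, hμ, -⟩ := exists_invariant_measure_of_averages T fun _ => Classical.arbitrary X
  exact ⟨μ, hμ⟩

/-- A uniquely ergodic flow whose invariant measure charges all nonempty open sets is minimal. -/
theorem IsUniquelyErgodic.isMinimal {T : X ≃ₜ X} (hT : IsUniquelyErgodic T) (μ : Measure X)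
    [IsProbabilityMeasure μ] [μ.Regular] [μ.IsOpenPosMeasure] (hμ : MeasurePreserving T μ μ) :
    IsMinimal T := by
  intro x
  by_contra hx
  rw [dense_iff_closure_eq] at hx
  obtain ⟨y, hy⟩ := (ne_univ_iff_exists_notMem _).mp hx
  -- A Urysohn function vanishing on the orbit closure has zero averages along the orbit, yet a
  -- positive integral against a measure of full support.
  obtain ⟨G, hG0, hG1, hG⟩ := exists_continuous_zero_one_of_isClosed
    (isClosed_closure (s := range fun n : ℤ => (T ^ n) x)) isClosed_singleton
    (disjoint_singleton_right.mpr hy)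
  obtain ⟨ν, hν, h⟩ := exists_invariant_measure_of_averages T fun _ => x
  rw [hT.unique hν ⟨inferInstance, inferInstance, hμ⟩] at h
  have h1 := h (-G) 0 <| .of_forall fun N => by
    refine le_of_eq ?_
    simp only [birkhoffAverage, birkhoffSum]
    rw [Finset.sum_eq_zero, smul_zero]
    intro k _
    have : G (T^[k] x) = 0 := hG0 (subset_closure ⟨k, zpow_natCast_apply_eq_iterate T k x⟩)
    simp [this]
  simp only [ContinuousMap.coe_neg, Pi.neg_apply, integral_neg] at h1
  have h2 : 0 < ∫ z, G z ∂μ :=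
    G.continuous.integral_pos_of_hasCompactSupport_nonneg_nonzero
      (HasCompactSupport.of_compactSpace _) (fun z => (hG z).1)
      (x := y) (by rw [hG1 rfl]; exact one_ne_zero)
  linarith

end KrylovBogoliubov

/-! ### Orbit closures in distal flows -/

section Distal

variable {X : Type*} [TopologicalSpace X] [CompactSpace X] [T2Space X]

/-- Every orbit closure of a distal flow is minimal. -/
theorem IsDistal.mem_closure_orbit {T : X ≃ₜ X} (hT : IsDistal T) {x y : X}
    (hy : y ∈ closure (range fun n : ℤ => (T ^ n) x)) :
    x ∈ closure (range fun n : ℤ => (T ^ n) y) := by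
  let _ : TopologicalSpace (Function.End X) := inferInstanceAs (TopologicalSpace (X → X))
  have : T2Space (Function.End X) := inferInstanceAs (T2Space (X → X))
  have : CompactSpace (Function.End X) := inferInstanceAs (CompactSpace (X → X))
  have hev : ∀ z : X, Continuous fun p : Function.End X => p z := fun z => continuous_apply z
  have hright : ∀ r : Function.End X, Continuous fun p : Function.End X => p * r := fun r =>
    continuous_pi fun z => continuous_apply (r z)
  let τ : ℤ → Function.End X := fun n => ⇑(T ^ n)
  have hleft : ∀ n, Continuous fun p : Function.End X => τ n * p := fun n =>
    continuous_pi fun z => (T ^ n).continuous.comp (continuous_apply z)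
  have hτ : ∀ m n, τ m * τ n = τ (m + n) := fun m n => by
    funext z
    exact (zpow_add_apply T m n z).symm
  -- The Ellis enveloping semigroup, compact in the topology of pointwise convergence.
  let E : Set (Function.End X) := closure (range τ)
  have hE : ∀ p ∈ E, ∀ q ∈ E, p * q ∈ E := by
    have h1 : ∀ n, ∀ q ∈ E, τ n * q ∈ E := fun n q hq =>
      map_mem_closure (hleft n) hq (by rintro _ ⟨m, rfl⟩; exact ⟨n + m, (hτ n m).symm⟩)
    intro p hp q hq
    have h2 : p * q ∈ closure E :=
      map_mem_closure (f := fun p => p * q) (hright q) hp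
        (by rintro _ ⟨n, rfl⟩; exact h1 n q hq)
    rwa [isClosed_closure.closure_eq] at h2
  obtain ⟨p, hp, hpx⟩ : y ∈ (fun p : Function.End X => p x) '' E := by
    rw [image_closure_of_isCompact isClosed_closure.isCompact (hev x).continuousOn, ← range_comp]
    exact hy
  -- An idempotent in the left ideal `E p`. Once it is known to be the identity, `q` is a left
  -- inverse of `p` in `E` and carries `y = p x` back to `x`.
  obtain ⟨_, ⟨q, hq, rfl⟩, hu⟩ := exists_idempotent_in_compact_subsemigroup hright
    ((fun q => q * p) '' E) (Nonempty.image _ ⟨p, hp⟩)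
    (isClosed_closure.isCompact.image (hright p)) (by
      rintro _ ⟨q, hq, rfl⟩ _ ⟨q', hq', rfl⟩
      exact ⟨q * p * q', hE _ (hE _ hq _ hp) _ hq', rfl⟩)
  have hqE : q * p ∈ E := hE _ hq _ hp
  -- An idempotent `u` sends the pair `(u z, z)` to the diagonal, so these points are proximal;
  -- distality forces `u z = z`.
  have hid : ∀ z, (q * p) z = z := by
    intro z
    by_contra hz
    obtain ⟨V, hV, hVn⟩ := hT _ _ hz
    have h1 : ((q * p) ((q * p) z), (q * p) z) ∈
        closure (range fun n : ℤ => ((T ^ n) ((q * p) z), (T ^ n) z)) :=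
      map_mem_closure (f := fun r : Function.End X => (r ((q * p) z), r z))
        ((hev _).prodMk (hev _)) hqE (by rintro _ ⟨n, rfl⟩; exact ⟨n, rfl⟩)
    have h2 : (q * p) ((q * p) z) = (q * p) z := congrFun hu z
    rw [h2] at h1
    obtain ⟨_, h3, n, rfl⟩ := mem_closure_iff_nhds.mp h1 V (nhds_le_nhdsSet (mem_diagonal ((q * p) z)) hV)
    exact hVn n h3
  have hx : x = q y := by rw [← hpx]; exact (hid x).symm
  rw [hx]
  exact map_mem_closure (f := fun r : Function.End X => r y) (hev y) hq
    (by rintro _ ⟨n, rfl⟩; exact ⟨n, rfl⟩)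

/-- Any `y` lies in the orbit closure of `x`, so by symmetry `x` lies in that of `y`, which is
invariant and therefore contains the whole dense orbit of `x`. -/
theorem IsDistal.isMinimal {T : X ≃ₜ X} (hT : IsDistal T) {x : X}
    (hx : Dense (range fun n : ℤ => (T ^ n) x)) : IsMinimal T := by
  intro y
  have h1 := hT.mem_closure_orbit (hx y)
  refine Dense.of_closure (hx.mono ?_)
  have h2 : ∀ n : ℤ, ∀ z ∈ closure (range fun n : ℤ => (T ^ n) y),
      (T ^ n) z ∈ closure (range fun n : ℤ => (T ^ n) y) := fun n z hz =>
    map_mem_closure (T ^ n).continuous hz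
      (by rintro _ ⟨m, rfl⟩; exact ⟨n + m, zpow_add_apply T n m y⟩)
  rintro _ ⟨n, rfl⟩
  exact h2 n x h1

end Distal

/-! ### Uniform means of sequences -/

section Means

/-- `u : ℤ → ℂ` has the uniform mean `κ`: all windows of some length have averages close to `κ`. -/
def HasUniformMean (u : ℤ → ℂ) (κ : ℂ) : Prop :=
  ∀ ε > 0, ∃ N : ℕ, 0 < N ∧ ∀ a : ℤ, ‖∑ n ∈ Finset.range N, u (a + n) - N * κ‖ ≤ ε * N

theorem sum_range_mul_eq {M : Type*} [AddCommMonoid M] (u : ℤ → M) (a : ℤ) (N k : ℕ) :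
    ∑ n ∈ Finset.range (k * N), u (a + n) =
      ∑ i ∈ Finset.range k, ∑ n ∈ Finset.range N, u (a + i * N + n) := by
  induction k with
  | zero => simp
  | succ k ih =>
    rw [Finset.sum_range_succ, ← ih, add_mul, one_mul, Finset.sum_range_add]
    congr 1
    refine Finset.sum_congr rfl fun n _ => ?_
    push_cast
    congr 1
    ring

theorem norm_window_mul_le {u : ℤ → ℂ} {κ : ℂ} {ε : ℝ} {N : ℕ}
    (h : ∀ a : ℤ, ‖∑ n ∈ Finset.range N, u (a + n) - N * κ‖ ≤ ε * N) (k : ℕ) (a : ℤ) :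
    ‖∑ n ∈ Finset.range (k * N), u (a + n) - (k * N : ℕ) * κ‖ ≤ ε * (k * N : ℕ) := by
  have h1 : ∑ n ∈ Finset.range (k * N), u (a + n) - (k * N : ℕ) * κ =
      ∑ i ∈ Finset.range k, (∑ n ∈ Finset.range N, u (a + i * N + n) - N * κ) := by
    rw [sum_range_mul_eq, Finset.sum_sub_distrib]
    simp
    ring
  rw [h1]
  refine (norm_sum_le_of_le _ fun i _ => h _).trans (le_of_eq ?_)
  simp
  ring

/-- A bound for windows of length `N` at all positions passes to multiples of `N`, so the product of
the individual lengths works for all sequences. -/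
theorem HasUniformMean.exists_common {ι : Type*} (s : Finset ι) {u : ι → ℤ → ℂ} {κ : ι → ℂ}
    (h : ∀ i ∈ s, HasUniformMean (u i) (κ i)) {ε : ℝ} (hε : 0 < ε) :
    ∃ N : ℕ, 0 < N ∧ ∀ i ∈ s, ∀ a : ℤ,
      ‖∑ n ∈ Finset.range N, u i (a + n) - N * κ i‖ ≤ ε * N := by
  classical
  induction s using Finset.induction_on with
  | empty => exact ⟨1, one_pos, by simp⟩
  | insert j s hj ih =>
    obtain ⟨N, hN, hs⟩ := ih fun i hi => h i (Finset.mem_insert_of_mem hi)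
    obtain ⟨N', hN', hj'⟩ := h j (Finset.mem_insert_self j s) ε hε
    refine ⟨N' * N, Nat.mul_pos hN' hN, fun i hi a => ?_⟩
    rcases Finset.mem_insert.mp hi with rfl | hi
    · rw [mul_comm N' N]
      exact norm_window_mul_le hj' N a
    · exact norm_window_mul_le (hs i hi) N' a

theorem HasUniformMean.const (c : ℂ) : HasUniformMean (fun _ => c) c :=
  fun ε hε => ⟨1, one_pos, fun a => by simpa using hε.le⟩

/-- A sequence with bounded partial sums has mean zero. -/
theorem HasUniformMean.of_bounded_sums {u : ℤ → ℂ} {C : ℝ}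
    (h : ∀ (N : ℕ) (a : ℤ), ‖∑ n ∈ Finset.range N, u (a + n)‖ ≤ C) : HasUniformMean u 0 := by
  intro ε hε
  obtain ⟨N, hN⟩ := exists_nat_gt (C / ε)
  refine ⟨N + 1, N.succ_pos, fun a => ?_⟩
  rw [mul_zero, sub_zero]
  refine (h _ a).trans ?_
  rw [div_lt_iff₀ hε] at hN
  push_cast
  nlinarith

/-- A sequence has a uniform mean if its restrictions to the residue classes modulo `M` do. -/
theorem HasUniformMean.of_residues {u : ℤ → ℂ} {M : ℕ} (hM : 0 < M)
    (h : ∀ r : ℤ, ∃ κ, HasUniformMean (fun n => u (M * n + r)) κ) :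
    ∃ κ, HasUniformMean u κ := by
  choose κ hκ using h
  have hM' : (M : ℤ) ≠ 0 := by positivity
  have hshift : ∀ r n : ℤ, u (M * n + r) = u (M * (r / M + n) + r % M) := fun r n => by
    congr 1
    linear_combination -(Int.mul_ediv_add_emod r M)
  have hres : ∀ r, HasUniformMean (fun n => u (M * n + r)) (κ (r % M)) := by
    intro r ε hε
    obtain ⟨N, hN, h⟩ := hκ (r % M) ε hε
    refine ⟨N, hN, fun a => ?_⟩
    have h1 := h (r / M + a)
    simp only [add_assoc] at h1
    simpa only [hshift r] using h1
  -- The sum over a complete residue system does not depend on where the window starts; divided by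
  -- `M` it is the mean sought.
  have hK : ∀ a : ℤ, ∑ r ∈ Finset.range M, κ ((a + r) % M) =
      ∑ r ∈ Finset.range M, κ ((r : ℤ) % M) := by
    have hstep : ∀ a : ℤ, ∑ r ∈ Finset.range M, κ ((a + 1 + r) % M) =
        ∑ r ∈ Finset.range M, κ ((a + r) % M) := by
      intro a
      have h1 := Finset.sum_range_succ (fun r : ℕ => κ ((a + r) % M)) M
      have h2 := Finset.sum_range_succ' (fun r : ℕ => κ ((a + r) % M)) M
      rw [h1] at h2
      simp only [Int.add_emod_right, Nat.cast_zero, add_zero, add_left_inj] at h2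
      rw [h2]
      refine Finset.sum_congr rfl fun r _ => ?_
      push_cast
      congr 2
      ring
    intro a
    induction a using Int.induction_on with
    | zero => simp
    | succ i ih => rw [hstep, ih]
    | pred i ih => rw [← ih, ← hstep, sub_add_cancel]
  refine ⟨(∑ r ∈ Finset.range M, κ ((r : ℤ) % M)) / M, fun ε hε => ?_⟩
  obtain ⟨N, hN, h⟩ := HasUniformMean.exists_common (Finset.range M)
    (u := fun r n => u (M * n + r)) (fun r _ => hres r) hε
  have hall : ∀ r a : ℤ, ‖∑ n ∈ Finset.range N, u (M * (a + n) + r) - N * κ (r % M)‖ ≤ ε * N := by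
    intro r a
    have hr := Int.emod_nonneg r hM'
    have hr' := Int.emod_lt_of_pos r (show (0 : ℤ) < M by positivity)
    have h1 := h (r % M).toNat (by rw [Finset.mem_range]; omega) (r / M + a)
    rw [Int.toNat_of_nonneg hr, Int.emod_emod_of_dvd _ dvd_rfl] at h1
    simp only [add_assoc] at h1
    simpa only [hshift r] using h1
  refine ⟨N * M, Nat.mul_pos hN hM, fun a => ?_⟩
  have h1 : ∑ n ∈ Finset.range (N * M), u (a + n) - (N * M : ℕ) *
      ((∑ r ∈ Finset.range M, κ ((r : ℤ) % M)) / M) = ∑ r ∈ Finset.range M,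
        (∑ n ∈ Finset.range N, u (M * (0 + n) + (a + r)) - N * κ ((a + r) % M)) := by
    rw [sum_range_mul_eq, Finset.sum_sub_distrib, Finset.sum_comm, ← Finset.mul_sum, hK]
    congr 1
    · refine Finset.sum_congr rfl fun r _ => Finset.sum_congr rfl fun n _ => ?_
      congr 1
      ring
    · have : (M : ℂ) ≠ 0 := by exact_mod_cast hM.ne'
      push_cast
      field_simp
  rw [h1]
  refine (norm_sum_le_of_le _ fun r _ => hall _ 0).trans (le_of_eq ?_)
  simp
  ring

theorem norm_window_shift_sub_le {u : ℤ → ℂ} (hu : ∀ n, ‖u n‖ ≤ 1) (a : ℤ) (N h : ℕ) :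
    ‖∑ n ∈ Finset.range N, u (a + n + h) - ∑ n ∈ Finset.range N, u (a + n)‖ ≤ 2 * h := by
  induction h with
  | zero => simp
  | succ h ih =>
    have h1 := Finset.sum_range_succ (fun n : ℕ => u (a + n + h)) N
    have h2 := Finset.sum_range_succ' (fun n : ℕ => u (a + n + h)) N
    rw [h1] at h2
    have h3 : ∑ n ∈ Finset.range N, u (a + n + (h + 1 : ℕ)) =
        ∑ n ∈ Finset.range N, u (a + (n + 1 : ℕ) + h) := by
      refine Finset.sum_congr rfl fun r _ => ?_
      push_cast
      congr 1
      ring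
    rw [h3, show ∑ n ∈ Finset.range N, u (a + (n + 1 : ℕ) + h) - ∑ n ∈ Finset.range N, u (a + n) =
      (∑ n ∈ Finset.range N, u (a + n + h) - ∑ n ∈ Finset.range N, u (a + n)) +
        (u (a + N + h) - u (a + (0 : ℕ) + h)) by linear_combination -h2]
    calc _ ≤ 2 * (h : ℝ) + (1 + 1) :=
          norm_add_le_of_le ih (norm_sub_le_of_le (hu _) (hu _))
      _ = 2 * (h + 1 : ℕ) := by push_cast; ring

open scoped ComplexConjugate in
/-- Van der Corput's lemma. -/
theorem HasUniformMean.of_correlations {u : ℤ → ℂ} (hu : ∀ n, ‖u n‖ ≤ 1)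
    (h : ∀ j : ℕ, 0 < j → HasUniformMean (fun n => u (n + j) * conj (u n)) 0) :
    HasUniformMean u 0 := by
  intro ε hε
  -- This makes the diagonal terms, `H N` in total, at most `ε² / 8` of `H² N`; the off-diagonal
  -- correlations will cost the same again.
  obtain ⟨H, hH⟩ := exists_nat_gt (8 / ε ^ 2)
  have hε2 : 0 < ε ^ 2 := by positivity
  have hH0 : 0 < (H : ℝ) := lt_trans (by positivity) hH
  obtain ⟨N₀, hN₀, hcor⟩ := HasUniformMean.exists_common (Finset.Ico 1 H)
    (u := fun j n => u (n + j) * conj (u n)) (κ := fun _ => 0)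
    (fun j hj => h j (by simp at hj; omega)) (ε := ε ^ 2 / 8) (by positivity)
  -- With `N ≥ m`, the boundary error `2 H²` from replacing `u` by short-window sums is at most half
  -- of the allowed `H N ε`.
  obtain ⟨m, hm⟩ := exists_nat_gt (4 * H / ε)
  set N := m * N₀ with hN
  have hm0 : 0 < m := by
    have : (0 : ℝ) < m := lt_trans (by positivity) hm
    exact_mod_cast this
  have hNpos : 0 < N := Nat.mul_pos hm0 hN₀
  have hNR : (0 : ℝ) < N := by exact_mod_cast hNpos
  have hNm : (m : ℝ) ≤ N := by
    rw [hN]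
    exact_mod_cast Nat.le_mul_of_pos_right m hN₀
  refine ⟨N, hNpos, fun a => ?_⟩
  rw [mul_zero, sub_zero]
  have hcor' : ∀ j ∈ Finset.Ico 1 H, ∀ b : ℤ,
      ‖∑ n ∈ Finset.range N, u (b + n + j) * conj (u (b + n))‖ ≤ ε ^ 2 / 8 * N := by
    intro j hj b
    have h1 := norm_window_mul_le (u := fun n => u (n + j) * conj (u n)) (κ := 0) (hcor j hj) m b
    rw [mul_zero, sub_zero] at h1
    exact h1
  -- the sums over short windows
  let S : ℕ → ℂ := fun n => ∑ k ∈ Finset.range H, u (a + n + k)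
  have h1 : ‖∑ n ∈ Finset.range N, S n - H * ∑ n ∈ Finset.range N, u (a + n)‖ ≤ 2 * H ^ 2 := by
    have e : ∑ n ∈ Finset.range N, S n - H * ∑ n ∈ Finset.range N, u (a + n) =
        ∑ k ∈ Finset.range H,
          (∑ n ∈ Finset.range N, u (a + n + k) - ∑ n ∈ Finset.range N, u (a + n)) := by
      rw [Finset.sum_sub_distrib, Finset.sum_const, Finset.card_range, nsmul_eq_mul,
        Finset.sum_comm]
    have e2 : ∀ k ∈ Finset.range H, ‖∑ n ∈ Finset.range N, u (a + n + k) -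
        ∑ n ∈ Finset.range N, u (a + n)‖ ≤ 2 * (H : ℝ) := fun k hk =>
      (norm_window_shift_sub_le hu a N k).trans (by
        have : k ≤ H := (Finset.mem_range.mp hk).le
        gcongr)
    rw [e]
    refine (norm_sum_le_of_le _ e2).trans (le_of_eq ?_)
    rw [Finset.sum_const, Finset.card_range, nsmul_eq_mul]
    ring
  have hpair : ∀ k ∈ Finset.range H, ∀ l ∈ Finset.range H,
      ‖∑ n ∈ Finset.range N, u (a + n + k) * conj (u (a + n + l))‖ ≤
        (if k = l then (N : ℝ) else 0) + ε ^ 2 / 8 * N := by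
    intro k hk l hl
    rw [Finset.mem_range] at hk hl
    have key : ∀ k l : ℕ, k < H → l < k →
        ‖∑ n ∈ Finset.range N, u (a + n + k) * conj (u (a + n + l))‖ ≤ ε ^ 2 / 8 * N := by
      intro k l hk hl
      convert hcor' (k - l) (by simp; omega) (a + l) using 5 with n hn
      · rw [Nat.cast_sub hl.le]
        ring_nf
      · ring_nf
    rcases lt_trichotomy k l with hkl | hkl | hkl
    · rw [if_neg hkl.ne, zero_add]
      convert key l k hl hkl using 1
      rw [← RCLike.norm_conj, map_sum]
      congr 1
      refine Finset.sum_congr rfl fun n _ => ?_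
      rw [map_mul, RCLike.conj_conj, mul_comm]
    · rw [if_pos hkl]
      refine (norm_sum_le_of_le _ (n := fun _ => (1 : ℝ)) fun n _ => ?_).trans ?_
      · rw [norm_mul, RCLike.norm_conj]
        exact mul_le_one₀ (hu _) (norm_nonneg _) (hu _)
      · simp
        positivity
    · rw [if_neg hkl.ne', zero_add]
      exact key k l hk hkl
  have h2 : ∑ n ∈ Finset.range N, ‖S n‖ ^ 2 ≤ H * N + H ^ 2 * (ε ^ 2 / 8 * N) := by
    have h3 : ((∑ n ∈ Finset.range N, ‖S n‖ ^ 2 : ℝ) : ℂ) = ∑ k ∈ Finset.range H,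
        ∑ l ∈ Finset.range H, ∑ n ∈ Finset.range N, u (a + n + k) * conj (u (a + n + l)) := by
      push_cast
      simp_rw [← Complex.mul_conj', S, map_sum, Finset.sum_mul_sum]
      rw [Finset.sum_comm]
      refine Finset.sum_congr rfl fun k _ => ?_
      rw [Finset.sum_comm]
    have h4 : ∑ n ∈ Finset.range N, ‖S n‖ ^ 2 =
        ‖((∑ n ∈ Finset.range N, ‖S n‖ ^ 2 : ℝ) : ℂ)‖ := by
      rw [Complex.norm_real, Real.norm_of_nonneg (Finset.sum_nonneg fun _ _ => sq_nonneg _)]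
    rw [h4, h3]
    refine (norm_sum_le_of_le _ fun k hk => norm_sum_le_of_le _ fun l hl =>
      hpair k hk l hl).trans (le_of_eq ?_)
    simp only [Finset.sum_add_distrib, Finset.sum_const, Finset.card_range, nsmul_eq_mul]
    rw [Finset.sum_congr rfl fun k hk => by rw [Finset.sum_ite_eq, if_pos hk]]
    simp
    ring
  have h3 : ‖∑ n ∈ Finset.range N, S n‖ ^ 2 ≤ N * ∑ n ∈ Finset.range N, ‖S n‖ ^ 2 := by
    calc _ ≤ (∑ n ∈ Finset.range N, ‖S n‖) ^ 2 := by gcongr; exact norm_sum_le _ _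
      _ ≤ _ := by simpa using sq_sum_le_card_mul_sum_sq (s := Finset.range N) (f := fun n => ‖S n‖)
  have h4 : ‖∑ n ∈ Finset.range N, S n‖ ≤ H * N * (ε / 2) := by
    refine abs_le_of_sq_le_sq' ?_ (by positivity) |>.2
    rw [div_lt_iff₀ hε2] at hH
    calc _ ≤ _ := h3
      _ ≤ N * (H * N + H ^ 2 * (ε ^ 2 / 8 * N)) := by gcongr
      _ = H * N ^ 2 * (1 + H * ε ^ 2 / 8) := by ring
      _ ≤ H * N ^ 2 * (H * ε ^ 2 / 4) := by gcongr; linarith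
      _ = _ := by ring
  have h5 : H * ‖∑ n ∈ Finset.range N, u (a + n)‖ ≤ H * N * (ε / 2) + 2 * H ^ 2 := by
    have : (H : ℝ) * ‖∑ n ∈ Finset.range N, u (a + n)‖ =
        ‖(H : ℂ) * ∑ n ∈ Finset.range N, u (a + n)‖ := by simp
    rw [this]
    calc _ = ‖∑ n ∈ Finset.range N, S n -
          (∑ n ∈ Finset.range N, S n - H * ∑ n ∈ Finset.range N, u (a + n))‖ := by congr 1; ring
      _ ≤ _ := norm_sub_le_of_le h4 h1
  have h6 : 2 * H ≤ N * (ε / 2) := by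
    rw [div_lt_iff₀ hε] at hm
    nlinarith
  refine le_of_mul_le_mul_left (h5.trans ?_) hH0
  nlinarith

end Means

/-! ### Polynomial sequences in the circle -/

section PolynomialSequences

variable {G : Type*} [AddCommGroup G]

/-- The `d`-th difference of `p` is constant with value `β`. -/
def HasDifference : ℕ → G → (ℤ → G) → Prop
  | 0, β, p => ∀ n, p n = β
  | d + 1, β, p => HasDifference d β fun n => p (n + 1) - p n

namespace HasDifference

theorem add {d : ℕ} {β γ : G} {p q : ℤ → G} (hp : HasDifference d β p)
    (hq : HasDifference d γ q) : HasDifference d (β + γ) fun n => p n + q n := by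
  induction d generalizing p q with
  | zero => intro n; simp only [hp n, hq n]
  | succ d ih =>
    have := ih hp hq
    simp only [HasDifference]
    convert this using 2
    abel

theorem neg {d : ℕ} {β : G} {p : ℤ → G} (hp : HasDifference d β p) :
    HasDifference d (-β) fun n => -p n := by
  induction d generalizing p with
  | zero => intro n; simp only [hp n]
  | succ d ih =>
    have := ih hp
    simp only [HasDifference]
    convert this using 2
    abel

theorem zero (d : ℕ) : HasDifference d (0 : G) fun _ => 0 := by
  induction d with
  | zero => intro n; rfl
  | succ d ih => simpa [HasDifference] using ih

theorem sum {ι : Type*} (s : Finset ι) {d : ℕ} {β : ι → G} {p : ι → ℤ → G}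
    (h : ∀ i ∈ s, HasDifference d (β i) (p i)) :
    HasDifference d (∑ i ∈ s, β i) fun n => ∑ i ∈ s, p i n := by
  classical
  induction s using Finset.induction_on with
  | empty => simpa using zero d
  | insert j s hj ih =>
    simp only [Finset.sum_insert hj]
    exact (h j (Finset.mem_insert_self j s)).add
      (ih fun i hi => h i (Finset.mem_insert_of_mem hi))

theorem succ_zero {d : ℕ} {β : G} {p : ℤ → G} (hp : HasDifference d β p) :
    HasDifference (d + 1) 0 p := by
  induction d generalizing p with
  | zero => intro n; simp [hp n, hp (n + 1)]
  | succ d ih => exact ih hp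

theorem exists_of_succ_zero {d : ℕ} {p : ℤ → G} (hp : HasDifference (d + 1) 0 p) :
    ∃ β, HasDifference d β p := by
  induction d generalizing p with
  | zero =>
    refine ⟨p 0, fun n => ?_⟩
    have h : ∀ n, p (n + 1) = p n := fun n => sub_eq_zero.mp (hp n)
    induction n using Int.induction_on with
    | zero => rfl
    | succ i ih => rw [h, ih]
    | pred i ih => rw [← ih, ← h, sub_add_cancel]
  | succ d ih => exact ih hp

theorem mono {d e : ℕ} (hde : d ≤ e) {p : ℤ → G} (hp : HasDifference d 0 p) :
    HasDifference e 0 p := by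
  induction e, hde using Nat.le_induction with
  | base => exact hp
  | succ e _ ih => exact ih.succ_zero

theorem sub_eq_sum (p : ℤ → G) (n : ℤ) (h : ℕ) :
    p (n + h) - p n = ∑ i ∈ Finset.range h, (p (n + i + 1) - p (n + i)) := by
  have := Finset.sum_range_sub (fun i : ℕ => p (n + i)) h
  simp only [Nat.cast_zero, add_zero] at this
  rw [← this]
  refine Finset.sum_congr rfl fun i _ => ?_
  push_cast
  rw [add_assoc]

/-- Passing to an arithmetic progression multiplies the `d`-th difference by `M ^ d`. -/
theorem comp_mul_add {d : ℕ} {β : G} {p : ℤ → G} (hp : HasDifference d β p) (M : ℕ) (r : ℤ) :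
    HasDifference d (M ^ d • β) fun n => p (M * n + r) := by
  induction d generalizing β p r with
  | zero => intro n; simp [hp (M * n + r)]
  | succ d ih =>
    have h1 := sum (Finset.range M) fun i _ => ih hp (r + i)
    simp only [HasDifference]
    convert h1 using 1
    · simp [pow_succ', mul_smul]
    · funext n
      have h2 := sub_eq_sum p (M * n + r) M
      rw [show (M : ℤ) * (n + 1) + r = M * n + r + M by ring, h2]
      simp only [add_assoc]

theorem comp_add {d : ℕ} {β : G} {p : ℤ → G} (hp : HasDifference d β p) (r : ℤ) :
    HasDifference d β fun n => p (n + r) := by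
  simpa using hp.comp_mul_add 1 r

/-- The telescoping sum of `h` first differences. It drives the van der Corput induction:
correlating lowers the degree and multiplies the leading difference by `h`. -/
theorem comp_add_sub {d : ℕ} {β : G} {p : ℤ → G} (hp : HasDifference (d + 1) β p) (h : ℕ) :
    HasDifference d (h • β) fun n => p (n + h) - p n := by
  have h1 := sum (Finset.range h) fun i _ => comp_add (d := d) hp i
  convert h1 using 1
  · simp
  · funext n
    exact sub_eq_sum p n h

/-- By the binomial theorem `(n + 1)^k - n^k` is a combination of lower powers. -/
theorem pow_zsmul (k : ℕ) (a : G) : HasDifference (k + 1) 0 fun n : ℤ => n ^ k • a := by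
  induction k using Nat.strong_induction_on generalizing a with
  | _ k ih =>
    simp only [HasDifference]
    have h1 := sum (Finset.range k) (d := k) (β := fun _ => (0 : G))
      (p := fun i n => n ^ i • (k.choose i • a)) fun i hi =>
        (ih i (Finset.mem_range.mp hi) _).mono (Finset.mem_range.mp hi)
    simp only [Finset.sum_const_zero] at h1
    convert h1 using 2 with n
    rw [← sub_smul, add_pow, Finset.sum_range_succ]
    simp only [one_pow, mul_one, Nat.choose_self, Nat.cast_one, add_sub_cancel_right,
      Finset.sum_smul]
    refine Finset.sum_congr rfl fun i _ => ?_
    rw [mul_smul, natCast_zsmul]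

end HasDifference

open AddCircle

theorem toCircle_ne_one {β : UnitAddCircle} (hβ : β ≠ 0) : (toCircle β : ℂ) ≠ 1 := by
  rw [← Circle.coe_one, Ne, Circle.coe_inj, ← AddCircle.toCircle_zero (T := 1)]
  exact fun h => hβ (injective_toCircle one_ne_zero h)

/-- In degree one these are geometric sums with ratio different from `1`, hence bounded. In higher
degree van der Corput's lemma applies: the correlations have leading difference `j β`, again of
infinite order. -/
theorem hasUniformMean_toCircle_zero {d : ℕ} {β : UnitAddCircle} {p : ℤ → UnitAddCircle}
    (hp : HasDifference (d + 1) β p) (hβ : ∀ m : ℕ, 0 < m → m • β ≠ 0) :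
    HasUniformMean (fun n => (toCircle (p n) : ℂ)) 0 := by
  induction d generalizing β p with
  | zero =>
    have h1 : (toCircle β : ℂ) - 1 ≠ 0 :=
      sub_ne_zero.mpr (toCircle_ne_one (by simpa using hβ 1 one_pos))
    refine HasUniformMean.of_bounded_sums (C := 2 / ‖(toCircle β : ℂ) - 1‖) fun N a => ?_
    rw [le_div_iff₀ (norm_pos_iff.mpr h1), ← norm_mul, Finset.sum_mul]
    have h2 : ∀ n : ℕ, (toCircle (p (a + n)) : ℂ) * ((toCircle β : ℂ) - 1) =
        (toCircle (p (a + (n + 1 : ℕ))) : ℂ) - toCircle (p (a + n)) := by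
      intro n
      have h3 : p (a + (n + 1 : ℕ)) = p (a + n) + β := by
        have := hp (a + n)
        rw [sub_eq_iff_eq_add'] at this
        rw [← this]
        push_cast
        rw [add_assoc]
      rw [h3, toCircle_add, Circle.coe_mul]
      ring
    simp only [h2]
    rw [Finset.sum_range_sub fun n : ℕ => (toCircle (p (a + n)) : ℂ)]
    refine (norm_sub_le _ _).trans ?_
    rw [Circle.norm_coe, Circle.norm_coe]
    norm_num
  | succ d ih =>
    refine HasUniformMean.of_correlations (fun n => (Circle.norm_coe _).le) fun j hj => ?_
    have h1 := ih (hp.comp_add_sub j) fun m hm => by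
      rw [← mul_smul]
      exact hβ _ (Nat.mul_pos hm hj)
    convert h1 using 2 with n
    rw [sub_eq_add_neg, toCircle_add, Circle.coe_mul, toCircle_neg, Circle.coe_inv_eq_conj]

/-- Weyl's theorem: exponentials of polynomial sequences have uniform means. -/
theorem exists_hasUniformMean_toCircle {d : ℕ} {β : UnitAddCircle} {p : ℤ → UnitAddCircle}
    (hp : HasDifference d β p) : ∃ κ, HasUniformMean (fun n => (toCircle (p n) : ℂ)) κ := by
  induction d generalizing β p with
  | zero =>
    refine ⟨toCircle β, ?_⟩
    convert HasUniformMean.const (toCircle β : ℂ) using 2 with n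
    rw [hp n]
  | succ d ih =>
    by_cases hβ : ∀ m : ℕ, 0 < m → m • β ≠ 0
    · exact ⟨0, hasUniformMean_toCircle_zero hp hβ⟩
    -- If `M β = 0`, restricting to residue classes modulo `M` kills the leading difference and the
    -- degree drops.
    · push Not at hβ
      obtain ⟨M, hM, hMβ⟩ := hβ
      refine HasUniformMean.of_residues hM fun r => ?_
      have h1 := hp.comp_mul_add M r
      rw [pow_succ, mul_smul, hMβ, smul_zero] at h1
      obtain ⟨γ, hγ⟩ := h1.exists_of_succ_zero
      exact ih hγ

end PolynomialSequences

/-! ### Unique ergodicity from uniform means -/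

section UniformMeans

variable {X : Type*} [TopologicalSpace X] [CompactSpace X] [T2Space X] [MeasurableSpace X]
  [BorelSpace X]

omit [T2Space X] in
theorem continuous_integral_continuousMap (μ : Measure X) [IsProbabilityMeasure μ] :
    Continuous fun F : C(X, ℂ) => ∫ x, F x ∂μ := by
  refine (LipschitzWith.of_dist_le_mul (K := 1) fun F F' => ?_).continuous
  rw [NNReal.coe_one, one_mul, dist_eq_norm, dist_eq_norm, ← integral_sub]
  · refine (norm_integral_le_of_norm_le_const (C := ‖F - F'‖)
      (.of_forall fun x => (F - F').norm_coe_le_norm x)).trans ?_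
    simp
  · exact F.continuous.integrable_of_hasCompactSupport (HasCompactSupport.of_compactSpace _)
  · exact F'.continuous.integrable_of_hasCompactSupport (HasCompactSupport.of_compactSpace _)

omit [T2Space X] in
-- The window estimate is a closed condition on the starting point, so it spreads from the dense
-- orbit to all of `X`; integrating it against an invariant measure gives the value.
theorem integral_eq_of_hasUniformMean {T : X ≃ₜ X} {x₀ : X}
    (hx₀ : Dense (range fun n : ℤ => (T ^ n) x₀)) {F : C(X, ℂ)} {κ : ℂ}
    (hF : HasUniformMean (fun n => F ((T ^ n) x₀)) κ) (μ : Measure X) [IsProbabilityMeasure μ]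
    (hμ : MeasurePreserving T μ μ) : ∫ x, F x ∂μ = κ := by
  have hint : ∀ n : ℕ, Integrable (fun x => F (T^[n] x)) μ := fun n =>
    (F.continuous.comp (T.continuous.iterate n)).integrable_of_hasCompactSupport
      (HasCompactSupport.of_compactSpace _)
  refine eq_of_forall_dist_le fun ε hε => ?_
  obtain ⟨N, hN, h⟩ := hF ε hε
  have hNR : (0 : ℝ) < N := by exact_mod_cast hN
  have hall : ∀ x, ‖∑ n ∈ Finset.range N, F (T^[n] x) - N * κ‖ ≤ ε * N := by
    have hclosed : IsClosed {x | ‖∑ n ∈ Finset.range N, F (T^[n] x) - N * κ‖ ≤ ε * N} := by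
      refine isClosed_le (continuous_norm.comp ((continuous_finsetSum _ fun n _ => ?_).sub
        continuous_const)) continuous_const
      exact F.continuous.comp (T.continuous.iterate n)
    refine fun x => hclosed.closure_subset_iff.mpr ?_ (hx₀ x)
    rintro _ ⟨a, rfl⟩
    rw [mem_ofPred_eq]
    convert h a using 5 with n
    rw [← zpow_natCast_apply_eq_iterate, ← zpow_add_apply, add_comm]
  have hsum : ∫ x, (∑ n ∈ Finset.range N, F (T^[n] x) - N * κ) ∂μ = N * (∫ x, F x ∂μ - κ) := by
    rw [integral_sub (integrable_finsetSum _ fun n _ => hint n) (integrable_const _),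
      integral_finsetSum _ fun n _ => hint n]
    have : ∀ n : ℕ, ∫ x, F (T^[n] x) ∂μ = ∫ x, F x ∂μ := fun n => by
      have hn := hμ.iterate n
      conv_rhs => rw [← hn.map_eq]
      rw [integral_map hn.measurable.aemeasurable]
      exact (F.continuous.measurable.aestronglyMeasurable)
    simp only [this, integral_const, probReal_univ, one_smul, Finset.sum_const, Finset.card_range,
      nsmul_eq_mul]
    ring
  have h1 := norm_integral_le_of_norm_le_const (μ := μ) (.of_forall hall)
  rw [hsum, norm_mul, probReal_univ, mul_one, Complex.norm_natCast, mul_comm] at h1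
  rw [dist_eq_norm]
  exact le_of_mul_le_mul_right h1 hNR

/-- Regular probability measures agree if they agree on a point-separating, self-adjoint monoid of
continuous functions. -/
theorem ext_of_integral_eq_on_submonoid (M : Submonoid C(X, ℂ))
    (hstar : ∀ F ∈ M, star F ∈ M) (hsep : ∀ x y, x ≠ y → ∃ F ∈ M, F x ≠ F y)
    {μ ν : Measure X} [IsProbabilityMeasure μ] [IsProbabilityMeasure ν] [μ.Regular] [ν.Regular]
    (h : ∀ F ∈ M, ∫ x, F x ∂μ = ∫ x, F x ∂ν) : μ = ν := by
  let A : StarSubalgebra ℂ C(X, ℂ) :=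
    { toSubalgebra := Algebra.adjoin ℂ M
      star_mem' := by
        change Algebra.adjoin ℂ (M : Set C(X, ℂ)) ≤ star (Algebra.adjoin ℂ (M : Set C(X, ℂ)))
        exact Algebra.adjoin_le fun F hF => Algebra.subset_adjoin (hstar F hF) }
  have hA : A.topologicalClosure = ⊤ :=
    ContinuousMap.starSubalgebra_topologicalClosure_eq_top_of_separatesPoints A fun x y hxy => by
      obtain ⟨F, hF, hne⟩ := hsep x y hxy
      exact ⟨F, ⟨F, Algebra.subset_adjoin hF, rfl⟩, hne⟩
  have hspan : ∀ F ∈ Algebra.adjoin ℂ (M : Set C(X, ℂ)), ∫ x, F x ∂μ = ∫ x, F x ∂ν := by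
    intro F hF
    have hint : ∀ (F : C(X, ℂ)) (m : Measure X) [IsProbabilityMeasure m], Integrable F m :=
      fun F m _ => F.continuous.integrable_of_hasCompactSupport (HasCompactSupport.of_compactSpace _)
    -- Since `M` is closed under products, the algebra it generates is its linear span, and
    -- linearity of the integral is enough.
    rw [← Subalgebra.mem_toSubmodule, Algebra.adjoin_eq_span, Submonoid.closure_eq] at hF
    induction hF using Submodule.span_induction with
    | mem F hF => exact h F hF
    | zero => simp
    | add F G _ _ hF hG =>
      simp only [ContinuousMap.add_apply]
      rw [integral_add (hint F ν) (hint G ν), integral_add (hint F μ) (hint G μ), hF, hG]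
    | smul c F _ hF =>
      simp only [ContinuousMap.smul_apply]
      rw [integral_smul, integral_smul, hF]
  have hall : ∀ F : C(X, ℂ), ∫ x, F x ∂μ = ∫ x, F x ∂ν := by
    intro F
    have hF : F ∈ A.topologicalClosure := by rw [hA]; trivial
    have hclosed : IsClosed {F : C(X, ℂ) | ∫ x, F x ∂μ = ∫ x, F x ∂ν} :=
      isClosed_eq (continuous_integral_continuousMap μ) (continuous_integral_continuousMap ν)
    exact hclosed.closure_subset_iff.mpr hspan hF
  refine Measure.ext_of_integral_eq_on_compactlySupported fun G => ?_
  have h1 := hall ⟨fun x => (G x : ℂ), Complex.continuous_ofReal.comp G.continuous⟩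
  simp only [ContinuousMap.coe_mk] at h1
  rw [integral_complex_ofReal, integral_complex_ofReal] at h1
  exact_mod_cast h1

/-- A flow with a dense orbit is uniquely ergodic if a point-separating, self-adjoint monoid of
continuous functions has uniform means along that orbit. -/
theorem isUniquelyErgodic_of_hasUniformMean {T : X ≃ₜ X} {x₀ : X}
    (hx₀ : Dense (range fun n : ℤ => (T ^ n) x₀)) (M : Submonoid C(X, ℂ))
    (hstar : ∀ F ∈ M, star F ∈ M) (hsep : ∀ x y, x ≠ y → ∃ F ∈ M, F x ≠ F y)
    (hmean : ∀ F ∈ M, ∃ κ, HasUniformMean (fun n => F ((T ^ n) x₀)) κ) :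
    IsUniquelyErgodic T := by
  have : Nonempty X := ⟨x₀⟩
  obtain ⟨μ, hμ⟩ := exists_invariant_measure T
  refine ⟨μ, hμ, fun ν hν => ?_⟩
  obtain ⟨_, _, hμT⟩ := hμ
  obtain ⟨_, _, hνT⟩ := hν
  refine ext_of_integral_eq_on_submonoid M hstar hsep fun F hF => ?_
  obtain ⟨κ, hκ⟩ := hmean F hF
  rw [integral_eq_of_hasUniformMean hx₀ hκ ν hνT, integral_eq_of_hasUniformMean hx₀ hκ μ hμT]

end UniformMeans

/-! ### The algebra of functions coming from a given point -/

section FactorAlgebra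

variable {X : Type*} [TopologicalSpace X] [CompactSpace X]

/-- The function `n ↦ F (T ^ n x₀)`. -/
noncomputable def orbitFunction (T : X ≃ₜ X) (x₀ : X) (F : C(X, ℂ)) : ℓ^∞(ℤ, ℂ) :=
  ⟨fun n => F ((T ^ n) x₀), memℓp_infty ⟨‖F‖, by
    rintro _ ⟨n, rfl⟩
    exact F.norm_coe_le_norm _⟩⟩

/-- The supremum over a dense orbit is the full supremum norm. As `C(X, ℂ)` is complete, the
functions read off at `x₀` form a closed set. -/
theorem isometry_orbitFunction {T : X ≃ₜ X} {x₀ : X}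
    (hx₀ : Dense (range fun n : ℤ => (T ^ n) x₀)) : Isometry (orbitFunction T x₀) := by
  refine Isometry.of_dist_eq fun F G => ?_
  rw [dist_eq_norm, dist_eq_norm]
  have hcoe : ∀ n, (orbitFunction T x₀ F - orbitFunction T x₀ G) n = (F - G) ((T ^ n) x₀) :=
    fun n => rfl
  refine le_antisymm ?_ ?_
  · refine lp.norm_le_of_forall_le (norm_nonneg _) fun n => ?_
    rw [hcoe]
    exact (F - G).norm_coe_le_norm _
  · rw [ContinuousMap.norm_le _ (norm_nonneg _)]
    have hclosed : IsClosed {x | ‖(F - G) x‖ ≤ ‖orbitFunction T x₀ F - orbitFunction T x₀ G‖} :=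
      isClosed_le (continuous_norm.comp (F - G).continuous) continuous_const
    refine fun x => hclosed.closure_subset_iff.mpr ?_ (hx₀ x)
    rintro _ ⟨n, rfl⟩
    rw [mem_ofPred_eq, ← hcoe]
    exact lp.norm_apply_le_norm ENNReal.top_ne_zero _ n

/-- The algebra of all functions `n ↦ F (T ^ n x₀)` with `F` continuous. -/
noncomputable def orbitAlgebra (T : X ≃ₜ X) (x₀ : X) : Subalgebra ℂ ℓ^∞(ℤ, ℂ) where
  carrier := range (orbitFunction T x₀)
  mul_mem' := by
    rintro _ _ ⟨F, rfl⟩ ⟨G, rfl⟩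
    exact ⟨F * G, rfl⟩
  add_mem' := by
    rintro _ _ ⟨F, rfl⟩ ⟨G, rfl⟩
    exact ⟨F + G, rfl⟩
  algebraMap_mem' c := ⟨algebraMap ℂ _ c, by
    ext n
    rfl⟩

theorem isClosed_orbitAlgebra {T : X ≃ₜ X} {x₀ : X}
    (hx₀ : Dense (range fun n : ℤ => (T ^ n) x₀)) :
    IsClosed (orbitAlgebra T x₀ : Set ℓ^∞(ℤ, ℂ)) :=
  (isometry_orbitFunction hx₀).isClosedEmbedding.isClosed_range

theorem translate_mem_orbitAlgebra {T : X ≃ₜ X} {x₀ : X} (m : ℤ) {f : ℓ^∞(ℤ, ℂ)}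
    (hf : f ∈ orbitAlgebra T x₀) : translate m f ∈ orbitAlgebra T x₀ := by
  obtain ⟨F, rfl⟩ := hf
  refine ⟨F.comp ⟨⇑(T ^ m), (T ^ m).continuous⟩, ?_⟩
  ext n
  change F ((T ^ m) ((T ^ n) x₀)) = F ((T ^ (n + m)) x₀)
  rw [← zpow_add_apply, add_comm]

theorem comesFrom_of_mem_orbitAlgebra {T : X ≃ₜ X} {x₀ : X} {f : ℓ^∞(ℤ, ℂ)}
    (hf : f ∈ orbitAlgebra T x₀) : ComesFrom f T := by
  obtain ⟨F, rfl⟩ := hf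
  exact ⟨F, x₀, fun n => rfl⟩

end FactorAlgebra

/-! ### Orbit closures as flows -/

section OrbitClosure

variable {X : Type*} [TopologicalSpace X]

/-- The closure of the two-sided orbit of `x`. -/
def orbitClosure (T : X ≃ₜ X) (x : X) : Set X := closure (range fun n : ℤ => (T ^ n) x)

theorem zpow_mem_orbitClosure (T : X ≃ₜ X) (x : X) (n : ℤ) {y : X} (hy : y ∈ orbitClosure T x) :
    (T ^ n) y ∈ orbitClosure T x :=
  map_mem_closure (T ^ n).continuous hy
    (by rintro _ ⟨m, rfl⟩; exact ⟨n + m, zpow_add_apply T n m x⟩)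

theorem apply_mem_orbitClosure_iff (T : X ≃ₜ X) (x y : X) :
    y ∈ orbitClosure T x ↔ T y ∈ orbitClosure T x := by
  refine ⟨fun h => by simpa using zpow_mem_orbitClosure T x 1 h, fun h => ?_⟩
  have h1 := zpow_mem_orbitClosure T x (-1) h
  rw [zpow_neg_one] at h1
  convert h1
  exact (T.symm_apply_apply y).symm

/-- The restriction of a flow to an orbit closure. -/
def orbitClosureFlow (T : X ≃ₜ X) (x : X) : orbitClosure T x ≃ₜ orbitClosure T x :=
  T.subtype (apply_mem_orbitClosure_iff T x)

theorem coe_orbitClosureFlow_zpow (T : X ≃ₜ X) (x : X) (n : ℤ) (y : orbitClosure T x) :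
    (((orbitClosureFlow T x ^ n) y : orbitClosure T x) : X) = (T ^ n) y := by
  have hpow : ∀ (n : ℕ) (y : orbitClosure T x),
      (((orbitClosureFlow T x ^ n) y : orbitClosure T x) : X) = (T ^ n) y := by
    intro n
    induction n with
    | zero => intro y; rfl
    | succ n ih =>
      intro y
      rw [pow_succ, pow_succ]
      exact ih _
  cases n with
  | ofNat n => exact hpow n y
  | negSucc n =>
    rw [zpow_negSucc, zpow_negSucc]
    have h1 := hpow (n + 1) (((orbitClosureFlow T x ^ (n + 1))⁻¹) y)
    have h2 : (orbitClosureFlow T x ^ (n + 1)) (((orbitClosureFlow T x ^ (n + 1))⁻¹) y) = y :=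
      (orbitClosureFlow T x ^ (n + 1)).apply_symm_apply y
    rw [h2] at h1
    rw [h1]
    exact ((T ^ (n + 1)).symm_apply_apply _).symm

/-- The point `x` of its orbit closure. -/
def orbitClosureBase (T : X ≃ₜ X) (x : X) : orbitClosure T x :=
  ⟨x, subset_closure ⟨0, rfl⟩⟩

theorem dense_orbitClosureFlow (T : X ≃ₜ X) (x : X) :
    Dense (range fun n : ℤ => (orbitClosureFlow T x ^ n) (orbitClosureBase T x)) := by
  intro y
  rw [closure_subtype, ← range_comp]
  have : (Subtype.val ∘ fun n : ℤ => (orbitClosureFlow T x ^ n) (orbitClosureBase T x)) =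
      fun n : ℤ => (T ^ n) x := funext fun n => coe_orbitClosureFlow_zpow T x n _
  rw [this]
  exact y.2

end OrbitClosure

/-! ### The Weyl algebra -/

section Weyl

open AddCircle

/-- Families of sequences in the circle, indexed by the generators of the Weyl algebra. -/
abbrev SequenceSpace : Type := ℝ × ℕ → ℤ → UnitAddCircle

/-- The shift on families of sequences. -/
def sequenceShift : SequenceSpace ≃ₜ SequenceSpace where
  toFun z i n := z i (n + 1)
  invFun z i n := z i (n - 1)
  left_inv z := by simp
  right_inv z := by simp
  continuous_toFun := by fun_prop
  continuous_invFun := by fun_prop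

theorem sequenceShift_zpow_apply (m : ℤ) (z : SequenceSpace) (i : ℝ × ℕ) (n : ℤ) :
    (sequenceShift ^ m) z i n = z i (n + m) := by
  induction m generalizing n with
  | zero => simp
  | succ m ih =>
    rw [add_comm, zpow_add_apply, zpow_one]
    exact (ih (n + 1)).trans (by congr 1; ring)
  | pred m ih =>
    rw [sub_eq_add_neg, add_comm, zpow_add_apply, zpow_neg_one]
    exact (ih (n - 1)).trans (by congr 1; ring)

/-- The family of the sequences `n ↦ n ^ k α`. -/
def weylPoint : SequenceSpace := fun i n => n ^ i.2 • (i.1 : UnitAddCircle)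

theorem hasDifference_weylPoint (i : ℝ × ℕ) : HasDifference (i.2 + 1) 0 (weylPoint i) :=
  HasDifference.pow_zsmul i.2 _

theorem isClosed_hasDifference (d : ℕ) (β : UnitAddCircle) :
    IsClosed {p : ℤ → UnitAddCircle | HasDifference d β p} := by
  induction d with
  | zero =>
    simp only [HasDifference, ofPred_forall]
    exact isClosed_iInter fun n => isClosed_eq (continuous_apply n) continuous_const
  | succ d ih =>
    exact ih.preimage (f := fun (p : ℤ → UnitAddCircle) n => p (n + 1) - p n) (by fun_prop)

/-- Vanishing of a fixed iterated difference is a closed, shift-invariant condition, so limits of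
shifts are again polynomial of the same degree bound. -/
theorem hasDifference_of_mem_orbitClosure {z : SequenceSpace}
    (hz : z ∈ orbitClosure sequenceShift weylPoint) (i : ℝ × ℕ) :
    HasDifference (i.2 + 1) 0 (z i) := by
  have hclosed : IsClosed {z : SequenceSpace | HasDifference (i.2 + 1) 0 (z i)} :=
    (isClosed_hasDifference (i.2 + 1) 0).preimage (f := fun z : SequenceSpace => z i)
      (continuous_apply i)
  refine hclosed.closure_subset_iff.mpr ?_ hz
  rintro _ ⟨m, rfl⟩
  have h1 := (hasDifference_weylPoint i).comp_add m
  rw [mem_ofPred_eq]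
  convert h1 using 1
  funext n
  exact sequenceShift_zpow_apply m weylPoint i n

theorem HasDifference.fwdDiff_iterate_eq {G : Type*} [AddCommGroup G] {d : ℕ} {β : G} {p : ℤ → G}
    (hp : HasDifference d β p) (n : ℤ) : (fwdDiff 1)^[d] p n = β := by
  induction d generalizing p with
  | zero => exact hp n
  | succ d ih => exact ih hp

/-- The last iterated difference that is not identically zero is constant, because the next one
vanishes. -/
theorem HasDifference.exists_ne_zero {G : Type*} [AddCommGroup G] {d : ℕ} {p : ℤ → G}
    (hp : HasDifference d 0 p) (hne : p ≠ 0) : ∃ e, ∃ β ≠ 0, HasDifference e β p := by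
  induction d with
  | zero => exact absurd (funext hp) hne
  | succ d ih =>
    obtain ⟨β, hβ⟩ := hp.exists_of_succ_zero
    rcases eq_or_ne β 0 with rfl | h
    · exact ih hβ
    · exact ⟨d, β, h, hβ⟩

theorem continuous_fwdDiff_iterate (d : ℕ) :
    Continuous fun p : ℤ → UnitAddCircle => (fwdDiff 1)^[d] p 0 := by
  have h1 : Continuous (fwdDiff 1 : (ℤ → UnitAddCircle) → ℤ → UnitAddCircle) := by
    unfold fwdDiff
    fun_prop
  exact (continuous_apply 0).comp (h1.iterate d)

/-- The orbit closure of the family of all `n ↦ n ^ k α`. -/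
abbrev weylFlow := orbitClosureFlow sequenceShift weylPoint

theorem weylFlow_zpow_apply (m : ℤ) (z : orbitClosure sequenceShift weylPoint) (i : ℝ × ℕ)
    (n : ℤ) : ((weylFlow ^ m) z : SequenceSpace) i n = (z : SequenceSpace) i (n + m) := by
  rw [coe_orbitClosureFlow_zpow, sequenceShift_zpow_apply]

instance : CompactSpace (orbitClosure sequenceShift weylPoint) :=
  isCompact_iff_compactSpace.mp isClosed_closure.isCompact

theorem continuous_coordinate (i : ℝ × ℕ) (n : ℤ) :
    Continuous fun z : orbitClosure sequenceShift weylPoint => (z : SequenceSpace) i n :=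
  (continuous_apply n).comp ((continuous_apply i).comp continuous_subtype_val)

/-- Two distinct points differ, in some coordinate, by a nonzero polynomial sequence. Its last
nonzero difference is a constant `β`, unchanged by the shift, whereas the same continuous expression
is `0` on the diagonal. -/
theorem isDistal_weylFlow : IsDistal weylFlow := by
  intro x y hxy
  obtain ⟨i, hi⟩ := Function.ne_iff.mp (Subtype.coe_injective.ne hxy)
  have h1 := (hasDifference_of_mem_orbitClosure x.2 i).add
    (hasDifference_of_mem_orbitClosure y.2 i).neg
  rw [neg_zero, add_zero] at h1
  obtain ⟨e, β, hβ, he⟩ := h1.exists_ne_zero fun h => hi <| funext fun n => by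
    have := congrFun h n
    rwa [← sub_eq_add_neg, Pi.zero_apply, sub_eq_zero] at this
  let D : orbitClosure sequenceShift weylPoint × orbitClosure sequenceShift weylPoint →
      UnitAddCircle := fun q => (fwdDiff 1)^[e]
        (fun n => (q.1 : SequenceSpace) i n + -(q.2 : SequenceSpace) i n) 0
  have hD : Continuous D := by
    refine (continuous_fwdDiff_iterate e).comp (continuous_pi fun n => ?_)
    exact ((continuous_coordinate i n).comp continuous_fst).add
      ((continuous_coordinate i n).comp continuous_snd).neg
  refine ⟨{q | D q ≠ β}, ?_, fun n hn => hn ?_⟩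
  · refine (isOpen_ne_fun hD continuous_const).mem_nhdsSet.mpr ?_
    rintro ⟨z, w⟩ hzw
    obtain rfl : z = w := hzw
    have h2 : D (z, z) = 0 := by
      simp only [D, add_neg_cancel]
      exact (HasDifference.zero e).fwdDiff_iterate_eq 0
    rw [mem_ofPred_eq, h2]
    exact hβ.symm
  · simp only [D, weylFlow_zpow_apply]
    exact (he.comp_add n).fwdDiff_iterate_eq 0

theorem isMinimal_weylFlow : IsMinimal weylFlow :=
  isDistal_weylFlow.isMinimal (dense_orbitClosureFlow _ _)

/-- The continuous functions that are exponentials of polynomial sequences along the orbit of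
`weylPoint`. -/
def weylMonoid : Submonoid C(orbitClosure sequenceShift weylPoint, ℂ) where
  carrier := {F | ∃ d, ∃ p : ℤ → UnitAddCircle, HasDifference d 0 p ∧
    ∀ n, F ((weylFlow ^ n) (orbitClosureBase _ _)) = toCircle (p n)}
  one_mem' := ⟨0, 0, fun _ => rfl, fun n => by simp⟩
  mul_mem' := by
    rintro F G ⟨d, p, hp, hF⟩ ⟨e, q, hq, hG⟩
    refine ⟨max d e, fun n => p n + q n, ?_, fun n => ?_⟩
    · simpa using (hp.mono (le_max_left d e)).add (hq.mono (le_max_right d e))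
    · rw [ContinuousMap.mul_apply, hF, hG, toCircle_add, Circle.coe_mul]

theorem star_mem_weylMonoid {F : C(orbitClosure sequenceShift weylPoint, ℂ)}
    (hF : F ∈ weylMonoid) : star F ∈ weylMonoid := by
  obtain ⟨d, p, hp, hF⟩ := hF
  refine ⟨d, fun n => -p n, by simpa using hp.neg, fun n => ?_⟩
  rw [ContinuousMap.star_apply, hF, toCircle_neg, Circle.coe_inv_eq_conj]
  rfl

/-- The exponential of a coordinate. -/
noncomputable def weylCoordinate (i : ℝ × ℕ) (m : ℤ) : C(orbitClosure sequenceShift weylPoint, ℂ) where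
  toFun z := toCircle ((z : SequenceSpace) i m)
  continuous_toFun :=
    continuous_subtype_val.comp (continuous_toCircle.comp (continuous_coordinate i m))

theorem weylCoordinate_apply (i : ℝ × ℕ) (m n : ℤ) :
    weylCoordinate i m ((weylFlow ^ n) (orbitClosureBase _ _)) =
      toCircle (weylPoint i (n + m)) := by
  change ((toCircle (((weylFlow ^ n) (orbitClosureBase _ _) : SequenceSpace) i m) : Circle) : ℂ) = _
  rw [weylFlow_zpow_apply, add_comm]
  rfl

theorem weylCoordinate_mem (i : ℝ × ℕ) (m : ℤ) : weylCoordinate i m ∈ weylMonoid :=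
  ⟨i.2 + 1, _, (hasDifference_weylPoint i).comp_add m, weylCoordinate_apply i m⟩

theorem isUniquelyErgodic_weylFlow
    [MeasurableSpace (orbitClosure sequenceShift weylPoint)]
    [BorelSpace (orbitClosure sequenceShift weylPoint)] : IsUniquelyErgodic weylFlow := by
  refine isUniquelyErgodic_of_hasUniformMean (dense_orbitClosureFlow _ _) weylMonoid
    (fun F => star_mem_weylMonoid) (fun x y hxy => ?_) fun F hF => ?_
  · obtain ⟨i, hi⟩ := Function.ne_iff.mp (Subtype.coe_injective.ne hxy)
    obtain ⟨m, hm⟩ := Function.ne_iff.mp hi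
    refine ⟨weylCoordinate i m, weylCoordinate_mem i m, fun h => hm ?_⟩
    exact injective_toCircle one_ne_zero (Circle.coe_inj.mp h)
  · obtain ⟨d, p, hp, hF⟩ := hF
    simp only [hF]
    exact exists_hasUniformMean_toCircle hp

theorem weylFunction_mem_orbitAlgebra (α : ℝ) (k : ℕ) :
    weylFunction α k ∈ orbitAlgebra weylFlow (orbitClosureBase _ _) := by
  refine ⟨weylCoordinate (α, k) 0, ?_⟩
  ext n
  refine (weylCoordinate_apply (α, k) 0 n).trans ?_
  rw [add_zero, weylPoint, ← AddCircle.coe_zsmul, AddCircle.toCircle_apply_mk, Circle.coe_exp]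
  change _ = Complex.exp _
  congr 2
  simp

/-- The orbit algebra of `weylFlow` is one of the algebras over which the infimum is taken, so a
single flow serves every element of `𝒲`. -/
theorem weylAlgebra_subset_strictlyErgodicDistalFunctions :
    (weylAlgebra : Set ℓ^∞(ℤ, ℂ)) ⊆ strictlyErgodicDistalFunctions := by
  have hle : weylAlgebra ≤ orbitAlgebra weylFlow (orbitClosureBase _ _) :=
    sInf_le ⟨isClosed_orbitAlgebra (dense_orbitClosureFlow _ _),
      fun m f => translate_mem_orbitAlgebra m, weylFunction_mem_orbitAlgebra⟩
  intro f hf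
  have hf' := comesFrom_of_mem_orbitAlgebra (hle hf)
  let _ : MeasurableSpace (orbitClosure sequenceShift weylPoint) := borel _
  have hborel : BorelSpace (orbitClosure sequenceShift weylPoint) := ⟨rfl⟩
  exact ⟨⟨_, inferInstance, inferInstance, inferInstance, weylFlow, isMinimal_weylFlow,
    isDistal_weylFlow, hf'⟩, ⟨_, inferInstance, inferInstance, inferInstance, inferInstance, hborel,
    weylFlow, ⟨isMinimal_weylFlow, isUniquelyErgodic_weylFlow⟩, hf'⟩⟩

end Weyl

/-! ### Arithmetic of Furstenberg's rotation number -/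

section Arithmetic

/-- The frequencies `n_{k+1} = 2 ^ v_{k+1}`, indexed from zero. -/
def frequency (k : ℕ) : ℕ := 2 ^ furstenbergV (k + 1)

theorem frequency_zero : frequency 0 = 2 := rfl

/-- The growth is tuned so that `2^{n_k} n_k / n_{k+1} = 1/2` exactly, the source of the sign change
at return times. -/
theorem frequency_succ (k : ℕ) : frequency (k + 1) = 2 ^ (frequency k + 1) * frequency k := by
  simp only [frequency, furstenbergV, ← pow_add]
  congr 1
  ring

theorem frequency_pos (k : ℕ) : 0 < frequency k := Nat.two_pow_pos _

theorem two_mul_frequency_le_succ (k : ℕ) : 2 * frequency k ≤ frequency (k + 1) := by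
  rw [frequency_succ]
  refine Nat.mul_le_mul_right _ ?_
  calc 2 = 2 ^ 1 := rfl
    _ ≤ _ := Nat.pow_le_pow_right (by norm_num) (by omega)

theorem frequency_strictMono : StrictMono frequency := strictMono_nat_of_lt_succ fun k => by
  have := two_mul_frequency_le_succ k
  have := frequency_pos k
  omega

theorem two_mul_add_two_le_frequency (k : ℕ) : 2 * k + 2 ≤ frequency k := by
  induction k with
  | zero => rfl
  | succ k ih =>
    have := two_mul_frequency_le_succ k
    omega

theorem two_pow_mul_frequency_le (k j : ℕ) : 2 ^ j * frequency k ≤ frequency (k + j) := by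
  induction j with
  | zero => simp
  | succ j ih =>
    have := two_mul_frequency_le_succ (k + j)
    rw [pow_succ, ← add_assoc]
    linarith

theorem frequency_dvd {j k : ℕ} (h : j ≤ k) : frequency j ∣ frequency k := by
  induction k, h using Nat.le_induction with
  | base => rfl
  | succ k _ ih => exact ih.trans ⟨_, by rw [frequency_succ, mul_comm]⟩

theorem frequency_dvd_two_pow (k : ℕ) : frequency k ∣ 2 ^ frequency k :=
  Nat.pow_dvd_pow 2 Nat.lt_two_pow_self.le

theorem furstenbergN_natCast_add_one (k : ℕ) : furstenbergN ((k : ℤ) + 1) = frequency k := by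
  have h1 : ((k : ℤ) + 1).sign = 1 := Int.sign_eq_one_of_pos (by positivity)
  have h2 : ((k : ℤ) + 1).natAbs = k + 1 := by omega
  rw [furstenbergN, h1, h2, frequency]
  simp

theorem furstenbergN_neg (k : ℤ) : furstenbergN (-k) = -furstenbergN k := by
  simp [furstenbergN]

theorem inv_frequency_add_le (k j : ℕ) :
    (1 : ℝ) / frequency (k + j) ≤ 1 / frequency k * (1 / 2) ^ j := by
  have h1 : (2 : ℝ) ^ j * frequency k ≤ frequency (k + j) := by
    exact_mod_cast two_pow_mul_frequency_le k j
  have h2 : (0 : ℝ) < frequency k := by exact_mod_cast frequency_pos k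
  rw [one_div_pow, one_div_mul_one_div, mul_comm]
  exact one_div_le_one_div_of_le (by positivity) h1

theorem summable_inv_frequency : Summable fun k : ℕ => (1 : ℝ) / frequency k := by
  refine Summable.of_nonneg_of_le (fun k => by positivity) (fun k => ?_)
    (summable_geometric_two.mul_left (1 / (frequency 0 : ℝ)))
  simpa using inv_frequency_add_le 0 k

/-- The tail `∑_{j > k} 1 / n_j` of the series defining the rotation number. -/
noncomputable def alphaTail (k : ℕ) : ℝ := ∑' j : ℕ, (1 : ℝ) / frequency (k + 1 + j)

theorem summable_alphaTail (k : ℕ) : Summable fun j : ℕ => (1 : ℝ) / frequency (k + 1 + j) := by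
  simpa only [add_comm] using (summable_nat_add_iff (k + 1)).mpr summable_inv_frequency

theorem furstenbergAlpha_eq (k : ℕ) :
    furstenbergAlpha = ∑ j ∈ Finset.range (k + 1), (1 : ℝ) / frequency j + alphaTail k := by
  have h1 := summable_inv_frequency.sum_add_tsum_nat_add (k + 1)
  rw [furstenbergAlpha, alphaTail]
  simp only [furstenbergN_natCast_add_one, Int.cast_natCast]
  rw [← h1]
  simp only [add_comm]

theorem alphaTail_eq (k : ℕ) : alphaTail k = 1 / frequency (k + 1) + alphaTail (k + 1) := by
  have h1 := furstenbergAlpha_eq k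
  have h2 := furstenbergAlpha_eq (k + 1)
  rw [Finset.sum_range_succ] at h2
  linarith

theorem alphaTail_pos (k : ℕ) : 0 < alphaTail k :=
  (summable_alphaTail k).tsum_pos (fun j => by positivity) 0
    (by have := frequency_pos (k + 1 + 0); positivity)

theorem alphaTail_le (k : ℕ) : alphaTail k ≤ 2 / frequency (k + 1) := by
  have h1 := (summable_alphaTail k).tsum_le_tsum (fun j => inv_frequency_add_le (k + 1) j)
    (summable_geometric_two.mul_left _)
  rw [tsum_mul_left, tsum_geometric_two] at h1
  refine h1.trans (le_of_eq ?_)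
  ring

theorem frequency_mul_alphaTail_le (k : ℕ) : frequency k * alphaTail k ≤ 1 / 2 ^ frequency k := by
  have h0 : (0 : ℝ) < frequency k := by exact_mod_cast frequency_pos k
  calc frequency k * alphaTail k ≤ frequency k * (2 / frequency (k + 1)) := by
        gcongr; exact alphaTail_le k
    _ = _ := by
        rw [frequency_succ]
        push_cast
        rw [pow_succ]
        field_simp

/-- The rotation number as a point of the circle. -/
noncomputable abbrev alphaCircle : UnitAddCircle := (furstenbergAlpha : UnitAddCircle)

/-- The frequencies divide one another, so `m / n_j` is an integer for `j ≤ k` and only the tail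
survives modulo `1`. -/
theorem nsmul_alphaCircle_eq {k m : ℕ} (h : frequency k ∣ m) :
    m • alphaCircle = ((m * alphaTail k : ℝ) : UnitAddCircle) := by
  have h1 : ∃ z : ℤ, (m : ℝ) * ∑ j ∈ Finset.range (k + 1), (1 : ℝ) / frequency j = z := by
    refine ⟨∑ j ∈ Finset.range (k + 1), ((m / frequency j : ℕ) : ℤ), ?_⟩
    rw [Finset.mul_sum, Int.cast_sum]
    refine Finset.sum_congr rfl fun j hj => ?_
    have hj0 : (frequency j : ℝ) ≠ 0 := by exact_mod_cast (frequency_pos j).ne'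
    rw [Int.cast_natCast, Nat.cast_div ((frequency_dvd (by simpa [Nat.lt_succ_iff] using hj)).trans h) hj0]
    ring
  obtain ⟨z, hz⟩ := h1
  rw [alphaCircle, ← AddCircle.coe_nsmul, furstenbergAlpha_eq k, nsmul_eq_mul, mul_add, hz,
    AddCircle.coe_add]
  have h2 : ((z : ℝ) : UnitAddCircle) = 0 := by
    rw [AddCircle.coe_eq_zero_iff]
    exact ⟨z, by simp⟩
  rw [h2, zero_add]

theorem norm_coe_le (x : ℝ) : ‖(x : UnitAddCircle)‖ ≤ |x| := by
  rw [UnitAddCircle.norm_eq]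
  simpa using round_le x 0

theorem norm_frequency_nsmul_alphaCircle_le (k : ℕ) :
    ‖frequency k • alphaCircle‖ ≤ 1 / 2 ^ k := by
  rw [nsmul_alphaCircle_eq dvd_rfl]
  refine (norm_coe_le _).trans ?_
  have := alphaTail_pos k
  rw [abs_of_nonneg (by positivity)]
  refine (frequency_mul_alphaTail_le k).trans ?_
  have := two_mul_add_two_le_frequency k
  gcongr
  · norm_num
  · omega

theorem two_pow_mul_alphaTail_le (j : ℕ) : 2 ^ frequency j * alphaTail j ≤ 1 / frequency j := by
  have h0 : (0 : ℝ) < frequency j := by exact_mod_cast frequency_pos j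
  have h1 := frequency_mul_alphaTail_le j
  rw [le_div_iff₀ (by positivity)] at h1 ⊢
  linarith

theorem norm_two_pow_nsmul_alphaCircle_le (j : ℕ) :
    ‖(2 ^ frequency j) • alphaCircle‖ ≤ 1 / 2 ^ j := by
  rw [nsmul_alphaCircle_eq (frequency_dvd_two_pow j)]
  refine (norm_coe_le _).trans ?_
  have := alphaTail_pos j
  rw [abs_of_nonneg (by positivity)]
  push_cast
  refine (two_pow_mul_alphaTail_le j).trans ?_
  have h1 : 2 ^ j ≤ frequency j := by
    have := two_pow_mul_frequency_le 0 j
    rw [frequency_zero, zero_add] at this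
    omega
  exact one_div_le_one_div_of_le (by positivity) (by exact_mod_cast h1)

/-- For `j < k` the tail factor `2^{-n_k}` outweighs `2^{n_j}`. For `j = k` the first term of the
tail contributes exactly `1/2`. For `j > k`, `n_j` divides `2^{n_j}` and what remains is at most
`n_k / n_j`. The error is summable in both indices, so times `2^{n_j}` can be added up. -/
theorem norm_two_pow_mul_frequency_nsmul_sub_le (j k : ℕ) :
    ‖(2 ^ frequency j * frequency k) • alphaCircle -
      (if j = k then ((1 / 2 : ℝ) : UnitAddCircle) else 0)‖ ≤ 1 / 2 ^ (j + k) := by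
  have hj0 : (0 : ℝ) < frequency j := by exact_mod_cast frequency_pos j
  have hk0 : (0 : ℝ) < frequency k := by exact_mod_cast frequency_pos k
  have hjt := alphaTail_pos j
  have hkt := alphaTail_pos k
  rcases lt_trichotomy j k with hjk | rfl | hjk
  · rw [if_neg hjk.ne, sub_zero, nsmul_alphaCircle_eq (dvd_mul_left _ _)]
    refine (norm_coe_le _).trans ?_
    rw [abs_of_nonneg (by positivity)]
    push_cast
    have h1 := frequency_mul_alphaTail_le k
    have h2 : frequency j + (j + k) ≤ frequency k := by
      have h3 := two_mul_frequency_le_succ j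
      have h4 := frequency_strictMono.monotone (show j + 1 ≤ k from hjk)
      have h5 := two_mul_add_two_le_frequency j
      obtain ⟨i, rfl⟩ : ∃ i, k = i + 1 := ⟨k - 1, by omega⟩
      have h6 := two_mul_frequency_le_succ i
      have h7 := two_mul_add_two_le_frequency i
      have h8 := frequency_strictMono.monotone (show j ≤ i by omega)
      omega
    calc (2 : ℝ) ^ frequency j * frequency k * alphaTail k
        = 2 ^ frequency j * (frequency k * alphaTail k) := by ring
      _ ≤ 2 ^ frequency j * (1 / 2 ^ frequency k) := by gcongr
      _ ≤ 2 ^ frequency j * (1 / 2 ^ (frequency j + (j + k))) := by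
          gcongr
          norm_num
      _ = _ := by rw [pow_add]; field_simp
  · rw [if_pos rfl, nsmul_alphaCircle_eq (dvd_mul_left _ _), alphaTail_eq, mul_add,
      AddCircle.coe_add]
    have h1 : (((2 ^ frequency j * frequency j : ℕ) : ℝ) * (1 / frequency (j + 1))) = 1 / 2 := by
      rw [frequency_succ]
      push_cast
      rw [pow_succ]
      field_simp
    rw [h1, add_sub_cancel_left]
    refine (norm_coe_le _).trans ?_
    have h2 := alphaTail_pos (j + 1)
    rw [abs_of_nonneg (by positivity)]
    have h3 := frequency_mul_alphaTail_le (j + 1)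
    have h4 := two_mul_add_two_le_frequency (j + 1)
    calc ((2 ^ frequency j * frequency j : ℕ) : ℝ) * alphaTail (j + 1)
        ≤ frequency (j + 1) * alphaTail (j + 1) := by
          gcongr
          rw [frequency_succ]
          gcongr
          · norm_num
          · omega
      _ ≤ _ := h3
      _ ≤ _ := by
          gcongr
          · norm_num
          · omega
  · rw [if_neg hjk.ne', sub_zero,
      nsmul_alphaCircle_eq ((frequency_dvd_two_pow j).trans (dvd_mul_right _ _))]
    refine (norm_coe_le _).trans ?_
    rw [abs_of_nonneg (by positivity)]
    push_cast
    have h1 := two_pow_mul_alphaTail_le j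
    have h2 : 2 ^ (j + k) * frequency k ≤ frequency j := by
      obtain ⟨i, rfl⟩ : ∃ i, j = i + 1 := ⟨j - 1, by omega⟩
      rw [frequency_succ]
      have h7 := two_mul_add_two_le_frequency i
      exact Nat.mul_le_mul (Nat.pow_le_pow_right (by norm_num) (by omega))
        (frequency_strictMono.monotone (by omega))
    have h3 : (2 : ℝ) ^ (j + k) * frequency k ≤ frequency j := by exact_mod_cast h2
    calc (2 : ℝ) ^ frequency j * frequency k * alphaTail j
        = frequency k * (2 ^ frequency j * alphaTail j) := by ring
      _ ≤ frequency k * (1 / frequency j) := by gcongr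
      _ ≤ _ := by
          rw [mul_one_div, div_le_div_iff₀ hj0 (by positivity)]
          linarith

/-- The times `∑_{K ≤ j ≤ L} 2 ^ n_j` along which the rotation returns to its starting point. -/
def returnTime (K L : ℕ) : ℕ := ∑ j ∈ Finset.Icc K L, 2 ^ frequency j

theorem sum_Icc_inv_two_pow_le (K L : ℕ) :
    ∑ j ∈ Finset.Icc K L, (1 : ℝ) / 2 ^ j ≤ 2 / 2 ^ K := by
  have h1 : ∑ j ∈ Finset.Icc K L, (1 : ℝ) / 2 ^ j =
      ∑ j ∈ Finset.range (L + 1 - K), 1 / 2 ^ K * (1 / 2 : ℝ) ^ j := by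
    rw [← Finset.Ico_add_one_right_eq_Icc, Finset.sum_Ico_eq_sum_range]
    refine Finset.sum_congr rfl fun j _ => ?_
    rw [pow_add, one_div_pow]
    field_simp
  rw [h1, ← Finset.mul_sum]
  have h2 := summable_geometric_two.sum_le_tsum (Finset.range (L + 1 - K))
    (fun j _ => by positivity)
  rw [tsum_geometric_two] at h2
  calc _ ≤ 1 / 2 ^ K * (2 : ℝ) := by gcongr
    _ = _ := by ring

theorem norm_returnTime_nsmul_le (K L : ℕ) : ‖returnTime K L • alphaCircle‖ ≤ 2 / 2 ^ K := by
  rw [returnTime, Finset.sum_smul]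
  exact (norm_sum_le_of_le _ fun j _ => norm_two_pow_nsmul_alphaCircle_le j).trans
    (sum_Icc_inv_two_pow_le K L)

theorem norm_returnTime_mul_frequency_nsmul_sub_le (K L k : ℕ) :
    ‖(returnTime K L * frequency k) • alphaCircle -
      (if k ∈ Finset.Icc K L then ((1 / 2 : ℝ) : UnitAddCircle) else 0)‖ ≤
        2 / 2 ^ K * (1 / 2) ^ k := by
  have h1 : (returnTime K L * frequency k) • alphaCircle -
      (if k ∈ Finset.Icc K L then ((1 / 2 : ℝ) : UnitAddCircle) else 0) =
      ∑ j ∈ Finset.Icc K L, ((2 ^ frequency j * frequency k) • alphaCircle -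
        (if j = k then ((1 / 2 : ℝ) : UnitAddCircle) else 0)) := by
    rw [Finset.sum_sub_distrib, Finset.sum_ite_eq', returnTime, Finset.sum_mul, Finset.sum_smul]
  rw [h1]
  refine (norm_sum_le_of_le _ fun j _ => norm_two_pow_mul_frequency_nsmul_sub_le j k).trans ?_
  calc ∑ j ∈ Finset.Icc K L, (1 : ℝ) / 2 ^ (j + k)
      = (∑ j ∈ Finset.Icc K L, (1 : ℝ) / 2 ^ j) * (1 / 2) ^ k := by
        rw [Finset.sum_mul]
        refine Finset.sum_congr rfl fun j _ => ?_
        rw [pow_add, one_div_pow]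
        field_simp
    _ ≤ _ := by
        gcongr
        exact sum_Icc_inv_two_pow_le K L

/-- If `m α` vanished modulo `1`, so would `m n_m α`; but this is represented by `m n_m` times the
tail after `n_m`, a number strictly between `0` and `1`. -/
theorem nsmul_alphaCircle_ne_zero {m : ℕ} (hm : 0 < m) : m • alphaCircle ≠ 0 := by
  intro h
  have hmR : (0 : ℝ) < m := by exact_mod_cast hm
  have h1 : (m * frequency m) • alphaCircle = 0 := by rw [mul_comm, mul_smul, h, smul_zero]
  rw [nsmul_alphaCircle_eq (dvd_mul_left _ _), AddCircle.coe_eq_zero_iff] at h1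
  obtain ⟨z, hz⟩ := h1
  rw [zsmul_eq_mul, mul_one] at hz
  have h2 := alphaTail_pos m
  have h0 : (0 : ℝ) < frequency m := by exact_mod_cast frequency_pos m
  have h3 : (0 : ℝ) < z := by
    rw [hz]
    push_cast
    positivity
  have h4 : (z : ℝ) < 1 := by
    rw [hz]
    push_cast
    have h5 := frequency_mul_alphaTail_le m
    have h6 : (m : ℝ) < 2 ^ frequency m := by
      have := two_mul_add_two_le_frequency m
      exact_mod_cast (show m < frequency m by omega).trans Nat.lt_two_pow_self
    calc (m : ℝ) * frequency m * alphaTail m = m * (frequency m * alphaTail m) := by ring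
      _ ≤ m * (1 / 2 ^ frequency m) := by gcongr
      _ < 1 := by rw [mul_one_div, div_lt_one (by positivity)]; exact h6
  norm_cast at h3 h4
  omega

theorem zsmul_alphaCircle_ne_zero {m : ℤ} (hm : m ≠ 0) : m • alphaCircle ≠ 0 := by
  intro h
  refine nsmul_alphaCircle_ne_zero (Int.natAbs_pos.mpr hm) ?_
  rcases Int.natAbs_eq m with h1 | h1 <;> rw [h1] at h
  · simpa using h
  · simpa using h

theorem dense_range_zsmul_alphaCircle : DenseRange fun n : ℤ => n • alphaCircle := by
  rw [AddCircle.denseRange_zsmul_iff, addOrderOf_eq_zero_iff']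
  exact fun m hm => nsmul_alphaCircle_ne_zero hm

end Arithmetic

/-! ### Lacunary cocycles -/

section Cocycles

open AddCircle

theorem norm_toCircle_sub_one_le (x : UnitAddCircle) :
    ‖(toCircle x : ℂ) - 1‖ ≤ 2 * Real.pi * ‖x‖ := by
  induction x using QuotientAddGroup.induction_on with
  | H y =>
    have h1 : ((y - round y : ℝ) : UnitAddCircle) = (y : UnitAddCircle) := by
      rw [AddCircle.coe_sub, sub_eq_self, AddCircle.coe_eq_zero_iff]
      exact ⟨round y, by simp⟩
    change ‖(toCircle (y : UnitAddCircle) : ℂ) - 1‖ ≤ 2 * Real.pi * ‖(y : UnitAddCircle)‖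
    rw [UnitAddCircle.norm_eq, ← h1, AddCircle.toCircle_apply_mk, Circle.coe_exp]
    have h2 := Real.norm_exp_I_mul_ofReal_sub_one_le (x := 2 * Real.pi / 1 * (y - round y))
    rw [mul_comm Complex.I] at h2
    refine h2.trans (le_of_eq ?_)
    rw [norm_mul, div_one, Real.norm_of_nonneg (by positivity), Real.norm_eq_abs]

theorem norm_toCircle_sub_toCircle_le (x y : UnitAddCircle) :
    ‖(toCircle x : ℂ) - toCircle y‖ ≤ 2 * Real.pi * ‖x - y‖ := by
  have h1 : (toCircle x : ℂ) - toCircle y = (toCircle (x - y) - 1) * toCircle y := by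
    rw [sub_mul, one_mul, ← Circle.coe_mul, ← toCircle_add, sub_add_cancel]
  rw [h1, norm_mul, Circle.norm_coe, mul_one]
  exact norm_toCircle_sub_one_le _

theorem toCircle_coe_half : (toCircle ((1 / 2 : ℝ) : UnitAddCircle) : ℂ) = -1 := by
  rw [AddCircle.toCircle_apply_mk, Circle.coe_exp, ← Complex.exp_pi_mul_I]
  congr 2
  push_cast
  ring

theorem norm_fourier_apply (n : ℤ) (x : UnitAddCircle) : ‖fourier n x‖ = 1 := Circle.norm_coe _

theorem fourier_add_arg (n : ℤ) (x y : UnitAddCircle) :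
    fourier n (x + y) = fourier n x * fourier n y := by
  rw [fourier_apply, smul_add, toCircle_add, Circle.coe_mul]
  rfl

theorem norm_fourier_frequency_sub_one_le (k : ℕ) :
    ‖fourier (frequency k) alphaCircle - 1‖ ≤ 2 * Real.pi * (1 / 2) ^ k := by
  rw [fourier_apply, natCast_zsmul, one_div_pow]
  refine (norm_toCircle_sub_one_le _).trans ?_
  gcongr
  exact norm_frequency_nsmul_alphaCircle_le k

variable {c : ℕ → ℝ} {C : ℝ}

theorem norm_coefficient_le (hc : ∀ k, |c k| ≤ C) (k : ℕ) :
    ‖(c k : ℂ) * (fourier (frequency k) alphaCircle - 1)‖ ≤ C * (2 * Real.pi) * (1 / 2) ^ k := by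
  rw [norm_mul, Complex.norm_real, mul_assoc]
  exact mul_le_mul (hc k) (norm_fourier_frequency_sub_one_le k) (norm_nonneg _)
    ((abs_nonneg _).trans (hc k))

variable (c) in
/-- The terms of the analytic half of Furstenberg's series. -/
noncomputable def seriesTerm (k : ℕ) : C(UnitAddCircle, ℂ) :=
  ((c k : ℂ) * (fourier (frequency k) alphaCircle - 1)) • fourier (frequency k)

variable (c) in
/-- The analytic half `∑_k c_k (exp(2πi n_k α) - 1) exp(2πi n_k x)` of Furstenberg's series. -/
noncomputable def analyticSeries : C(UnitAddCircle, ℂ) := ∑' k, seriesTerm c k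

/-- The factors `e(n_k α) - 1` decay geometrically, so boundedness of `c` already gives uniform
convergence. -/
theorem hasSum_seriesTerm (hc : ∀ k, |c k| ≤ C) : HasSum (seriesTerm c) (analyticSeries c) := by
  refine (Summable.of_norm_bounded (summable_geometric_two.mul_left (C * (2 * Real.pi)))
    fun k => ?_).hasSum
  rw [seriesTerm, norm_smul, fourier_norm, mul_one]
  exact norm_coefficient_le hc k

theorem hasSum_analyticSeries (hc : ∀ k, |c k| ≤ C) (x : UnitAddCircle) :
    HasSum (fun k => (c k : ℂ) * (fourier (frequency k) alphaCircle - 1) * fourier (frequency k) x)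
      (analyticSeries c x) :=
  (hasSum_seriesTerm hc).map (ContinuousMap.evalCLM ℂ x) (ContinuousMap.evalCLM ℂ x).continuous

/-- Furstenberg's cocycle with amplitude `t` and coefficients `c`. -/
noncomputable def cocycle (t : ℝ) (c : ℕ → ℝ) : C(UnitAddCircle, ℝ) where
  toFun x := t * (2 * (analyticSeries c x).re)
  continuous_toFun := continuous_const.mul (continuous_const.mul
    (Complex.continuous_re.comp (analyticSeries c).continuous))

theorem cocycle_apply (t : ℝ) (c : ℕ → ℝ) (x : UnitAddCircle) :
    cocycle t c x = t * (2 * (analyticSeries c x).re) := rfl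

/-- The terms of negative index are the conjugates of those of positive index, whence twice the real
part. The index `k` of `c` corresponds to `±(k + 1)`. -/
theorem hasFurstenbergSeries_cocycle (hc : ∀ k, |c k| ≤ C) (t : ℝ) {b : ℤ → ℝ}
    (hb : ∀ k : ℕ, b (k + 1) = c k) (hb' : ∀ k : ℕ, b (-(k + 1)) = c k) :
    HasFurstenbergSeries t b (cocycle t c) := by
  intro x
  have h1 := (hasSum_analyticSeries hc x).mul_left (t : ℂ)
  have h2 := (Complex.hasSum_conj'.mpr (hasSum_analyticSeries hc x)).mul_left (t : ℂ)
  let F : ℤ → ℂ := fun k => (t : ℂ) * ((fourier (furstenbergN k) alphaCircle - 1) * (b k : ℂ) *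
    fourier (furstenbergN k) x)
  -- `furstenbergN 0 = 0` because the sign of `0` is `0`; the term at `0` vanishes and the sum may
  -- run over all of `ℤ`.
  have hF0 : F 0 = 0 := by simp [F, furstenbergN]
  have hpos : HasSum (fun n : ℕ => F n) (t * analyticSeries c x) := by
    rw [← hasSum_nat_add_iff' 1]
    simp only [Finset.range_one, Finset.sum_singleton, Nat.cast_zero, hF0, sub_zero]
    refine h1.congr_fun fun k => ?_
    simp only [F]
    push_cast
    rw [furstenbergN_natCast_add_one, hb]
    ring
  have hneg : HasSum (fun n : ℕ => F (-(n + 1))) (t * starRingEnd ℂ (analyticSeries c x)) := by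
    refine h2.congr_fun fun k => ?_
    simp only [F]
    rw [furstenbergN_neg, furstenbergN_natCast_add_one, hb', fourier_neg, fourier_neg]
    simp only [map_mul, map_sub, map_one, Complex.conj_ofReal]
    ring
  have hsum : HasSum F (cocycle t c x) := by
    convert hpos.of_nat_of_neg_add_one hneg using 1
    rw [cocycle_apply, ← mul_add, Complex.add_conj]
    push_cast
    rfl
  refine (hasSum_subtype_iff_of_support_subset (s := {k : ℤ | k ≠ 0}) ?_).mpr hsum
  intro k hk h0
  rw [Function.mem_support] at hk
  exact hk (h0 ▸ hF0)

/-- The sum of `φ` over the first `q` points of the orbit of `x` under the rotation. -/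
noncomputable def rotationSum (φ : UnitAddCircle → ℝ) (q : ℕ) (x : UnitAddCircle) : ℝ :=
  ∑ i ∈ Finset.range q, φ (x + i • alphaCircle)

/-- Each term is the coboundary of `c_k e(n_k x)`, so its orbital sum telescopes. -/
theorem hasSum_rotationSum_analyticSeries (hc : ∀ k, |c k| ≤ C) (q : ℕ) (x : UnitAddCircle) :
    HasSum (fun k => (c k : ℂ) * (fourier (frequency k) (q • alphaCircle) - 1) *
      fourier (frequency k) x)
      (∑ i ∈ Finset.range q, analyticSeries c (x + i • alphaCircle)) := by
  induction q with
  | zero =>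
    simp only [zero_smul, fourier_eval_zero, sub_self, mul_zero, zero_mul, Finset.range_zero,
      Finset.sum_empty]
    exact hasSum_zero
  | succ q ih =>
    rw [Finset.sum_range_succ]
    convert ih.add (hasSum_analyticSeries hc (x + q • alphaCircle)) using 2 with k
    rw [add_smul, one_smul, fourier_add_arg, fourier_add_arg]
    ring

theorem norm_fourier_returnTime_sub_le (K L k : ℕ) :
    ‖fourier (frequency k) (returnTime K L • alphaCircle) -
      (if k ∈ Finset.Icc K L then -1 else 1)‖ ≤ 2 * Real.pi * (2 / 2 ^ K * (1 / 2) ^ k) := by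
  have h1 : (if k ∈ Finset.Icc K L then -1 else 1 : ℂ) =
      toCircle (if k ∈ Finset.Icc K L then ((1 / 2 : ℝ) : UnitAddCircle) else 0) := by
    split_ifs
    · exact toCircle_coe_half.symm
    · rw [toCircle_zero, Circle.coe_one]
  rw [h1, fourier_apply, natCast_zsmul, ← mul_smul]
  refine (norm_toCircle_sub_toCircle_le _ _).trans ?_
  gcongr
  rw [mul_comm]
  exact norm_returnTime_mul_frequency_nsmul_sub_le K L k

/-- Along the return times the orbital sums of the cocycle are nearly trigonometric polynomials. -/
theorem abs_rotationSum_cocycle_add_le (hc : ∀ k, |c k| ≤ C) {t : ℝ} (ht0 : 0 ≤ t) (ht1 : t ≤ 1)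
    (K L : ℕ) (x : UnitAddCircle) :
    |rotationSum (cocycle t c) (returnTime K L) x +
      4 * t * ∑ k ∈ Finset.Icc K L, c k * (fourier (frequency k) x).re| ≤
        16 * Real.pi * C / 2 ^ K := by
  have hC : 0 ≤ C := (abs_nonneg _).trans (hc 0)
  set Z := ∑ i ∈ Finset.range (returnTime K L), analyticSeries c (x + i • alphaCircle) with hZ
  set W := ∑ k ∈ Finset.Icc K L, (c k : ℂ) * fourier (frequency k) x with hW
  -- The idealized series: replacing `e(n_k q α)` by exactly `-1` inside `[K, L]` and `1` outside
  -- turns the factor `e(n_k q α) - 1` into `-2` or `0`.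
  have h1 : HasSum (fun k => if k ∈ Finset.Icc K L then
      -2 * ((c k : ℂ) * fourier (frequency k) x) else 0) (-2 * W) := by
    rw [hW, Finset.mul_sum]
    have h0 := hasSum_sum_of_ne_finset_zero (s := Finset.Icc K L) (f := fun k =>
      if k ∈ Finset.Icc K L then -2 * ((c k : ℂ) * fourier (frequency k) x) else 0)
      (L := SummationFilter.unconditional ℕ) fun k hk => if_neg hk
    rwa [Finset.sum_congr rfl fun k hk => if_pos hk] at h0
  have h2 := (hasSum_rotationSum_analyticSeries hc (returnTime K L) x).sub h1
  have h3 : ‖Z - -2 * W‖ ≤ C * (2 * Real.pi) * (2 / 2 ^ K) * 2 := by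
    refine h2.norm_le_of_bounded (hasSum_geometric_two.mul_left _) fun k => ?_
    have h4 : (c k : ℂ) * (fourier (frequency k) (returnTime K L • alphaCircle) - 1) *
        fourier (frequency k) x - (if k ∈ Finset.Icc K L then
          -2 * ((c k : ℂ) * fourier (frequency k) x) else 0) =
        (c k : ℂ) * (fourier (frequency k) (returnTime K L • alphaCircle) -
          (if k ∈ Finset.Icc K L then -1 else 1)) * fourier (frequency k) x := by
      split_ifs <;> ring
    rw [h4, norm_mul, norm_mul, norm_fourier_apply, mul_one, Complex.norm_real]
    calc _ ≤ C * (2 * Real.pi * (2 / 2 ^ K * (1 / 2) ^ k)) :=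
          mul_le_mul (hc k) (norm_fourier_returnTime_sub_le K L k) (norm_nonneg _) hC
      _ = _ := by ring
  have h5 : rotationSum (cocycle t c) (returnTime K L) x +
      4 * t * ∑ k ∈ Finset.Icc K L, c k * (fourier (frequency k) x).re =
        t * 2 * (Z - -2 * W).re := by
    have hZ' : Z.re = ∑ i ∈ Finset.range (returnTime K L),
        (analyticSeries c (x + i • alphaCircle)).re := Complex.re_sum _ _
    have hW' : W.re = ∑ k ∈ Finset.Icc K L, c k * (fourier (frequency k) x).re := by
      rw [hW, Complex.re_sum]
      exact Finset.sum_congr rfl fun k _ => Complex.re_ofReal_mul _ _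
    have hZW : (Z - -2 * W).re = Z.re + 2 * W.re := by simp
    rw [hZW, hZ', hW']
    simp only [rotationSum, cocycle_apply, ← Finset.mul_sum]
    ring
  rw [h5, abs_mul, abs_of_nonneg (by positivity)]
  calc t * 2 * |(Z - -2 * W).re| ≤ 1 * 2 * (C * (2 * Real.pi) * (2 / 2 ^ K) * 2) := by
        gcongr
        exact (Complex.abs_re_le_norm _).trans h3
    _ = _ := by ring

theorem cocycle_sub (hc : ∀ k, |c k| ≤ C) {c' : ℕ → ℝ} {C' : ℝ} (hc' : ∀ k, |c' k| ≤ C') (t : ℝ) :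
    cocycle t (fun k => c k - c' k) = cocycle t c - cocycle t c' := by
  have h1 : analyticSeries (fun k => c k - c' k) = analyticSeries c - analyticSeries c' := by
    rw [← ((hasSum_seriesTerm hc).sub (hasSum_seriesTerm hc')).tsum_eq, analyticSeries]
    congr 1
    funext k
    ext x
    simp only [seriesTerm, ContinuousMap.smul_apply, ContinuousMap.sub_apply, smul_eq_mul,
      Complex.ofReal_sub]
    ring
  ext x
  rw [ContinuousMap.sub_apply, cocycle_apply, cocycle_apply, cocycle_apply, h1,
    ContinuousMap.sub_apply, Complex.sub_re]
  ring

end Cocycles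

/-! ### Skew products -/

section SkewProducts

open AddCircle

variable (φ : C(UnitAddCircle, ℝ))

/-- The skew product over Furstenberg's rotation. -/
noncomputable abbrev skew : UnitAddCircle × UnitAddCircle ≃ₜ UnitAddCircle × UnitAddCircle :=
  skewProduct furstenbergAlpha φ

theorem skew_apply (p : UnitAddCircle × UnitAddCircle) :
    skew φ p = (p.1 + alphaCircle, p.2 + (φ p.1 : UnitAddCircle)) := rfl

theorem skew_iterate (q : ℕ) (p : UnitAddCircle × UnitAddCircle) :
    (skew φ)^[q] p = (p.1 + q • alphaCircle, p.2 + (rotationSum φ q p.1 : UnitAddCircle)) := by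
  induction q with
  | zero => simp [rotationSum]
  | succ q ih =>
    rw [Function.iterate_succ_apply', ih, skew_apply, rotationSum, rotationSum,
      Finset.sum_range_succ, AddCircle.coe_add, add_smul, one_smul]
    simp only [add_assoc]

/-- Powers of a skew product are skew. -/
theorem exists_skew_zpow (n : ℤ) : ∃ σ : UnitAddCircle → UnitAddCircle,
    ∀ p, (skew φ ^ n) p = (p.1 + n • alphaCircle, p.2 + σ p.1) := by
  have hnat : ∀ n : ℕ, ∃ σ : UnitAddCircle → UnitAddCircle,
      ∀ p, (skew φ ^ n) p = (p.1 + n • alphaCircle, p.2 + σ p.1) := fun n =>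
    ⟨fun x => (rotationSum φ n x : UnitAddCircle), fun p => by
      rw [pow_apply_eq_iterate, skew_iterate]⟩
  rcases n with n | n
  · simpa using hnat n
  · obtain ⟨σ, hσ⟩ := hnat (n + 1)
    refine ⟨fun x => -σ (x - (n + 1) • alphaCircle), fun p => ?_⟩
    rw [zpow_negSucc]
    change (skew φ ^ (n + 1)).symm p = _
    rw [Homeomorph.symm_apply_eq, hσ, negSucc_zsmul, ← sub_eq_add_neg]
    simp

/-- Points over different base points keep their base difference forever; points in one fibre keep
their vertical difference. -/
theorem isDistal_skew : IsDistal (skew φ) := by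
  rintro ⟨x, y⟩ ⟨x', y'⟩ hne
  by_cases hx : x = x'
  · subst hx
    have hy : y - y' ≠ 0 := fun h => hne (by rw [sub_eq_zero.mp h])
    refine ⟨{r | r.1.2 - r.2.2 ≠ y - y'}, ?_, fun n hn => hn ?_⟩
    · refine (isOpen_ne_fun (by fun_prop) continuous_const).mem_nhdsSet.mpr ?_
      rintro ⟨p, p'⟩ hp
      obtain rfl : p = p' := hp
      simpa using hy.symm
    · obtain ⟨σ, hσ⟩ := exists_skew_zpow φ n
      simp only [hσ]
      abel
  · have hx : x - x' ≠ 0 := sub_ne_zero.mpr hx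
    refine ⟨{r | r.1.1 - r.2.1 ≠ x - x'}, ?_, fun n hn => hn ?_⟩
    · refine (isOpen_ne_fun (by fun_prop) continuous_const).mem_nhdsSet.mpr ?_
      rintro ⟨p, p'⟩ hp
      obtain rfl : p = p' := hp
      simpa using hx.symm
    · obtain ⟨σ, hσ⟩ := exists_skew_zpow φ n
      simp only [hσ]
      abel

/-- A skew product is minimal if, at return times of the rotation, the orbital sums over the base
point `0` approximate every value. -/
theorem isMinimal_skew (h : ∀ y : UnitAddCircle, ∀ ε > 0, ∃ q : ℕ, ‖q • alphaCircle‖ < ε ∧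
    ‖(rotationSum φ q 0 : UnitAddCircle) - y‖ < ε) : IsMinimal (skew φ) := by
  intro p
  have hmem : ∀ n : ℤ, ∀ z ∈ orbitClosure (skew φ) p, (skew φ ^ n) z ∈ orbitClosure (skew φ) p :=
    fun n z hz => zpow_mem_orbitClosure _ _ n hz
  have hclosed : IsClosed (orbitClosure (skew φ) p) := isClosed_closure
  -- the projection to the base is onto
  have hproj : Prod.fst '' orbitClosure (skew φ) p = univ := by
    have h1 : IsClosed (Prod.fst '' orbitClosure (skew φ) p) :=
      (hclosed.isCompact.image continuous_fst).isClosed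
    rw [← h1.closure_eq, ← dense_iff_closure_eq]
    have h2 : Dense (range fun n : ℤ => p.1 + n • alphaCircle) := by
      have := (Homeomorph.addLeft p.1).surjective.denseRange.comp dense_range_zsmul_alphaCircle
        (Homeomorph.addLeft p.1).continuous
      exact this
    refine h2.mono ?_
    rintro _ ⟨n, rfl⟩
    obtain ⟨σ, hσ⟩ := exists_skew_zpow φ n
    exact ⟨(skew φ ^ n) p, subset_closure ⟨n, rfl⟩, by rw [hσ]⟩
  obtain ⟨⟨x₀, y₀⟩, hy₀, rfl⟩ : (0 : UnitAddCircle) ∈ Prod.fst '' orbitClosure (skew φ) p := by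
    rw [hproj]; trivial
  -- the fibre over the base point is contained in the orbit closure
  have hfibre : ∀ y, ((0, y) : UnitAddCircle × UnitAddCircle) ∈ orbitClosure (skew φ) p := by
    intro y
    rw [← hclosed.closure_eq, Metric.mem_closure_iff]
    intro ε hε
    obtain ⟨q, hq1, hq2⟩ := h (y - y₀) ε hε
    refine ⟨(skew φ ^ (q : ℤ)) (0, y₀), hmem q _ hy₀, ?_⟩
    rw [zpow_natCast_apply_eq_iterate, skew_iterate, dist_comm, Prod.dist_eq, max_lt_iff,
      dist_eq_norm, dist_eq_norm]
    refine ⟨by simpa using hq1, ?_⟩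
    rw [show ((0 : UnitAddCircle), y₀).2 + (rotationSum φ q 0 : UnitAddCircle) - y =
      (rotationSum φ q 0 : UnitAddCircle) - (y - y₀) by abel]
    exact hq2
  rw [dense_iff_closure_eq]
  refine eq_univ_of_forall fun z => ?_
  have h2 : Dense (range fun n : ℤ => n • alphaCircle) := dense_range_zsmul_alphaCircle
  -- Invariance moves the full fibre over `0` to the fibres over the dense set of multiples of `α`;
  -- closedness gives the rest.
  have h3 : ∀ x : UnitAddCircle, (x, z.2) ∈ orbitClosure (skew φ) p := by
    have h4 : IsClosed {x : UnitAddCircle | (x, z.2) ∈ orbitClosure (skew φ) p} :=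
      hclosed.preimage (by fun_prop)
    refine fun x => h4.closure_subset_iff.mpr ?_ (h2 x)
    rintro _ ⟨n, rfl⟩
    obtain ⟨σ, hσ⟩ := exists_skew_zpow φ n
    have h5 := hmem n _ (hfibre (z.2 - σ 0))
    rw [hσ] at h5
    simpa using h5
  exact h3 z.1

end SkewProducts

/-! ### Unique ergodicity of skew products -/

section UniqueErgodicity

open AddCircle

/-- Haar measure on the two-torus. -/
noncomputable abbrev torusMeasure : Measure (UnitAddCircle × UnitAddCircle) :=
  haarAddCircle.prod haarAddCircle

theorem measurePreserving_skew (φ : C(UnitAddCircle, ℝ)) :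
    MeasurePreserving (skew φ) torusMeasure torusMeasure := by
  have h1 : MeasurePreserving (fun x : UnitAddCircle => x + alphaCircle) haarAddCircle
      haarAddCircle := measurePreserving_add_right _ _
  refine h1.skew_product (g := fun x y => y + (φ x : UnitAddCircle)) ?_ (.of_forall fun x => ?_)
  · exact (continuous_snd.add ((AddCircle.continuous_mk' 1).comp
      (φ.continuous.comp continuous_fst))).measurable
  · exact (measurePreserving_add_right haarAddCircle (φ x : UnitAddCircle)).map_eq

/-- The characters of the two-torus. -/
noncomputable def torusCharacter (j m : ℤ) : C(UnitAddCircle × UnitAddCircle, ℂ) :=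
  ((fourier j).comp ContinuousMap.fst) * ((fourier m).comp ContinuousMap.snd)

theorem torusCharacter_apply (j m : ℤ) (p : UnitAddCircle × UnitAddCircle) :
    torusCharacter j m p = fourier j p.1 * fourier m p.2 := rfl

theorem norm_torusCharacter_apply (j m : ℤ) (p : UnitAddCircle × UnitAddCircle) :
    ‖torusCharacter j m p‖ = 1 := by
  rw [torusCharacter_apply, norm_mul, norm_fourier_apply, norm_fourier_apply, one_mul]

theorem torusCharacter_mul (i j k l : ℤ) :
    torusCharacter i j * torusCharacter k l = torusCharacter (i + k) (j + l) := by
  ext p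
  simp only [ContinuousMap.mul_apply, torusCharacter_apply, fourier_add]
  ring

theorem star_torusCharacter (j m : ℤ) : star (torusCharacter j m) = torusCharacter (-j) (-m) := by
  ext p
  simp only [ContinuousMap.star_apply, torusCharacter_apply, fourier_neg, star_mul']
  rfl

theorem torusCharacter_zero : torusCharacter 0 0 = 1 := by
  ext p
  rw [torusCharacter_apply, fourier_zero, fourier_zero]
  simp

/-- The monoid of characters of the two-torus. -/
def torusCharacters : Submonoid C(UnitAddCircle × UnitAddCircle, ℂ) where
  carrier := range fun q : ℤ × ℤ => torusCharacter q.1 q.2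
  one_mem' := ⟨(0, 0), torusCharacter_zero⟩
  mul_mem' := by
    rintro _ _ ⟨q, rfl⟩ ⟨r, rfl⟩
    exact ⟨q + r, (torusCharacter_mul _ _ _ _).symm⟩

/-- Measures on the torus are determined by their Fourier coefficients. Haar measure is itself
invariant, so the hypothesis covers both measures being compared. -/
theorem isUniquelyErgodic_skew_of_integral_torusCharacter (φ : C(UnitAddCircle, ℝ))
    (h : ∀ μ : Measure (UnitAddCircle × UnitAddCircle), IsProbabilityMeasure μ →
      MeasurePreserving (skew φ) μ μ → ∀ j m : ℤ, (j, m) ≠ (0, 0) →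
        ∫ p, torusCharacter j m p ∂μ = 0) : IsUniquelyErgodic (skew φ) := by
  refine ⟨torusMeasure, ⟨inferInstance, inferInstance, measurePreserving_skew φ⟩, ?_⟩
  rintro μ ⟨hμ, _, hμT⟩
  refine ext_of_integral_eq_on_submonoid torusCharacters ?_ ?_ ?_
  · rintro _ ⟨q, rfl⟩
    exact ⟨-q, (star_torusCharacter _ _).symm⟩
  · rintro ⟨x, y⟩ ⟨x', y'⟩ hne
    by_cases hx : x = x'
    · refine ⟨torusCharacter 0 1, ⟨(0, 1), rfl⟩, fun h => hne ?_⟩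
      simp only [torusCharacter_apply, fourier_zero, fourier_one, one_mul, Circle.coe_inj] at h
      rw [hx, injective_toCircle one_ne_zero h]
    · refine ⟨torusCharacter 1 0, ⟨(1, 0), rfl⟩, fun h => hx ?_⟩
      simp only [torusCharacter_apply, fourier_zero, fourier_one, mul_one, Circle.coe_inj] at h
      exact injective_toCircle one_ne_zero h
  · rintro _ ⟨⟨j, m⟩, rfl⟩
    by_cases hjm : (j, m) = (0, 0)
    · obtain ⟨rfl, rfl⟩ := Prod.mk.inj hjm
      simp [torusCharacter_zero]
    · rw [h μ hμ hμT j m hjm, h _ inferInstance (measurePreserving_skew φ) j m hjm]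

theorem integral_comp_iterate {X : Type*} [MeasurableSpace X] {μ : Measure X} {T : X → X}
    (hT : MeasurePreserving T μ μ) (q : ℕ) {F : X → ℂ} (hF : Measurable F) :
    ∫ x, F (T^[q] x) ∂μ = ∫ x, F x ∂μ := by
  have h := hT.iterate q
  conv_rhs => rw [← h.map_eq]
  exact (integral_map h.measurable.aemeasurable hF.aestronglyMeasurable).symm

variable {φ : C(UnitAddCircle, ℝ)} {μ : Measure (UnitAddCircle × UnitAddCircle)}
  [IsProbabilityMeasure μ]

omit [IsProbabilityMeasure μ] in
-- One step of the flow multiplies the integral by `e(jα)`, which is not `1`.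
theorem integral_torusCharacter_base (hμ : MeasurePreserving (skew φ) μ μ) {j : ℤ} (hj : j ≠ 0) :
    ∫ p, torusCharacter j 0 p ∂μ = 0 := by
  have h1 := integral_comp_iterate hμ 1 (torusCharacter j 0).continuous.measurable
  have h2 : ∀ p, torusCharacter j 0 ((skew φ)^[1] p) =
      fourier j alphaCircle * torusCharacter j 0 p := fun p => by
    rw [skew_iterate, torusCharacter_apply, torusCharacter_apply, fourier_add_arg, one_smul,
      fourier_zero, fourier_zero]
    ring
  simp only [h2] at h1
  rw [integral_const_mul] at h1
  have h3 : (fourier j alphaCircle - 1) * ∫ p, torusCharacter j 0 p ∂μ = 0 := by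
    rw [sub_mul, one_mul, h1, sub_self]
  exact (mul_eq_zero.mp h3).resolve_left
    (sub_ne_zero.mpr (toCircle_ne_one (zsmul_alphaCircle_ne_zero hj)))

/-- By Bessel's inequality, the Fourier coefficients of an invariant measure with a fixed vertical
frequency tend to zero. -/
theorem tendsto_integral_torusCharacter (hμ : MeasurePreserving (skew φ) μ μ) (m : ℤ) :
    Tendsto (fun j => ∫ p, torusCharacter j m p ∂μ) cofinite (𝓝 0) := by
  -- Base characters are orthonormal in `L²(μ)` because nontrivial ones have integral zero; the
  -- coefficients in question are their inner products with the character `(0, m)`.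
  let v : ℤ → Lp ℂ 2 μ := fun j => ContinuousMap.toLp 2 μ ℂ (torusCharacter (-j) 0)
  have hinner : ∀ i j k l, inner ℂ (ContinuousMap.toLp 2 μ ℂ (torusCharacter i j))
      (ContinuousMap.toLp 2 μ ℂ (torusCharacter k l)) =
      ∫ p, torusCharacter (k - i) (l - j) p ∂μ := by
    intro i j k l
    rw [ContinuousMap.inner_toLp]
    refine integral_congr_ae (.of_forall fun p => ?_)
    have h1 := congrArg (fun F => F p) (torusCharacter_mul k l (-i) (-j))
    rw [← star_torusCharacter] at h1
    simp only [sub_eq_add_neg]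
    exact h1
  have hv : Orthonormal ℂ v := by
    rw [orthonormal_iff_ite]
    intro i j
    rw [hinner]
    split_ifs with h
    · simp [h, torusCharacter_zero]
    · rw [sub_self, integral_torusCharacter_base hμ]
      omega
  have h1 := (hv.inner_products_summable
    (ContinuousMap.toLp 2 μ ℂ (torusCharacter 0 m))).tendsto_cofinite_zero
  have h2 : ∀ j, inner ℂ (v j) (ContinuousMap.toLp 2 μ ℂ (torusCharacter 0 m)) =
      ∫ p, torusCharacter j m p ∂μ := fun j => by
    rw [hinner, zero_sub, neg_neg, sub_zero]
  simp only [h2] at h1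
  rw [tendsto_zero_iff_norm_tendsto_zero]
  have h3 := h1.sqrt
  simpa using h3

theorem integral_fourier (l : ℤ) :
    ∫ u : UnitAddCircle, fourier l u ∂haarAddCircle = if l = 0 then 1 else 0 := by
  split_ifs with h
  · subst h
    simp
  · exact integral_eq_zero_of_add_right_eq_neg (fourier_add_half_inv_index h one_pos)

/-- Rapidly oscillating functions of the base variable decouple from an invariant measure. -/
theorem tendsto_integral_torusCharacter_mul (hμ : MeasurePreserving (skew φ) μ μ) (j m : ℤ)
    (Ψ : C(UnitAddCircle, ℂ)) :
    Tendsto (fun K => ∫ p, torusCharacter j m p * Ψ (frequency K • p.1) ∂μ) atTop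
      (𝓝 ((∫ u, Ψ u ∂haarAddCircle) * ∫ p, torusCharacter j m p ∂μ)) := by
  have hint : ∀ (Ψ : C(UnitAddCircle, ℂ)) (K : ℕ),
      Integrable (fun p => torusCharacter j m p * Ψ (frequency K • p.1)) μ := fun Ψ K =>
    ((torusCharacter j m).continuous.mul
      (Ψ.continuous.comp ((continuous_nsmul _).comp continuous_fst))).integrable_of_hasCompactSupport
        (HasCompactSupport.of_compactSpace _)
  have hint' : ∀ Ψ : C(UnitAddCircle, ℂ), Integrable Ψ haarAddCircle := fun Ψ =>
    Ψ.continuous.integrable_of_hasCompactSupport (HasCompactSupport.of_compactSpace _)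
  have hnorm : ∀ (Ψ : C(UnitAddCircle, ℂ)) (K : ℕ),
      ‖∫ p, torusCharacter j m p * Ψ (frequency K • p.1) ∂μ‖ ≤ ‖Ψ‖ := fun Ψ K => by
    refine (norm_integral_le_of_norm_le_const (C := ‖Ψ‖) (.of_forall fun p => ?_)).trans (by simp)
    rw [norm_mul, norm_torusCharacter_apply, one_mul]
    exact Ψ.norm_coe_le_norm _
  -- The functions with the desired limit form a closed subspace, so characters suffice. For `l ≠ 0`
  -- the frequencies `j + l n_K` are distinct, and Bessel's inequality gives limit zero.
  let S : Submodule ℂ C(UnitAddCircle, ℂ) :=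
    { carrier := {Ψ | Tendsto (fun K => ∫ p, torusCharacter j m p * Ψ (frequency K • p.1) ∂μ) atTop
        (𝓝 ((∫ u, Ψ u ∂haarAddCircle) * ∫ p, torusCharacter j m p ∂μ))}
      zero_mem' := by simp
      add_mem' := by
        intro Ψ Ψ' h h'
        have h1 := h.add h'
        rw [← add_mul, ← integral_add (hint' Ψ) (hint' Ψ')] at h1
        refine h1.congr fun K => ?_
        rw [← integral_add (hint Ψ K) (hint Ψ' K)]
        simp only [ContinuousMap.add_apply, mul_add]
      smul_mem' := by
        intro a Ψ h
        have h1 := h.const_mul a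
        have h2 : ∫ u, (a • Ψ) u ∂haarAddCircle = a * ∫ u, Ψ u ∂haarAddCircle :=
          integral_const_mul a Ψ
        rw [mem_ofPred_eq, h2, mul_assoc]
        refine h1.congr fun K => ?_
        rw [← integral_const_mul]
        refine integral_congr_ae (.of_forall fun p => ?_)
        simp only [ContinuousMap.smul_apply, smul_eq_mul]
        ring }
  have hfourier : ∀ l : ℤ, fourier l ∈ S := by
    intro l
    have h1 : ∀ K, ∫ p, torusCharacter j m p * fourier l (frequency K • p.1) ∂μ =
        ∫ p, torusCharacter (j + l * frequency K) m p ∂μ := fun K => by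
      refine integral_congr_ae (.of_forall fun p => ?_)
      have h2 : fourier l (frequency K • p.1) = fourier (l * frequency K) p.1 := by
        rw [fourier_apply, fourier_apply, mul_smul, natCast_zsmul]
      simp only [torusCharacter_apply, h2, fourier_add]
      ring
    change Tendsto _ _ _
    simp only [h1, integral_fourier]
    split_ifs with hl
    · simp [hl]
    · rw [zero_mul]
      have hinj : Function.Injective fun K : ℕ => j + l * frequency K := by
        intro K K' h
        simp only [add_right_inj, mul_eq_mul_left_iff, hl, or_false, Nat.cast_inj] at h
        exact frequency_strictMono.injective h
      have h3 := (tendsto_integral_torusCharacter hμ m).comp hinj.tendsto_cofinite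
      rwa [Nat.cofinite_eq_atTop] at h3
  have hclosed : IsClosed (S : Set C(UnitAddCircle, ℂ)) := by
    refine isClosed_of_closure_subset fun Ψ hΨ => ?_
    change Tendsto _ _ _
    rw [Metric.tendsto_atTop]
    intro ε hε
    obtain ⟨Ψ', hΨ', hd⟩ := Metric.mem_closure_iff.mp hΨ (ε / 3) (by positivity)
    obtain ⟨K₀, hK₀⟩ := Metric.tendsto_atTop.mp hΨ' (ε / 3) (by positivity)
    refine ⟨K₀, fun K hK => ?_⟩
    rw [dist_eq_norm] at hd
    have h1 := hnorm (Ψ - Ψ') K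
    have h2 : ‖(∫ u, (Ψ - Ψ') u ∂haarAddCircle) * ∫ p, torusCharacter j m p ∂μ‖ ≤ ‖Ψ - Ψ'‖ := by
      rw [norm_mul]
      refine (mul_le_mul (norm_integral_le_of_norm_le_const (.of_forall (Ψ - Ψ').norm_coe_le_norm))
        (norm_integral_le_of_norm_le_const (.of_forall fun p =>
          (norm_torusCharacter_apply j m p).le)) (norm_nonneg _) (by positivity)).trans ?_
      simp
    have h3 := hK₀ K hK
    simp only [ContinuousMap.sub_apply, mul_sub] at h1 h2
    rw [integral_sub (hint Ψ K) (hint Ψ' K)] at h1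
    rw [integral_sub (hint' Ψ) (hint' Ψ'), sub_mul] at h2
    rw [dist_eq_norm] at h3 ⊢
    calc _ = ‖(∫ p, torusCharacter j m p * Ψ (frequency K • p.1) ∂μ -
            ∫ p, torusCharacter j m p * Ψ' (frequency K • p.1) ∂μ) +
          (∫ p, torusCharacter j m p * Ψ' (frequency K • p.1) ∂μ -
            (∫ u, Ψ' u ∂haarAddCircle) * ∫ p, torusCharacter j m p ∂μ) -
          ((∫ u, Ψ u ∂haarAddCircle) * ∫ p, torusCharacter j m p ∂μ -
            (∫ u, Ψ' u ∂haarAddCircle) * ∫ p, torusCharacter j m p ∂μ)‖ := by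
          congr 1
          ring
      _ < ε / 3 + ε / 3 + ε / 3 :=
          (norm_sub_le_of_le (norm_add_le_of_le h1 h3.le) h2).trans_lt (by linarith)
      _ = ε := by ring
  have htop : Ψ ∈ (Submodule.span ℂ (range (@fourier 1))).topologicalClosure := by
    rw [span_fourier_closure_eq_top]
    trivial
  refine Submodule.topologicalClosure_minimal _ (Submodule.span_le.mpr ?_) hclosed htop
  rintro _ ⟨l, rfl⟩
  exact hfourier l

theorem norm_fourier_coe_sub_le (m : ℤ) (r s : ℝ) :
    ‖fourier m (r : UnitAddCircle) - fourier m (s : UnitAddCircle)‖ ≤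
      2 * Real.pi * (|(m : ℝ)| * |r - s|) := by
  rw [fourier_apply, fourier_apply]
  refine (norm_toCircle_sub_toCircle_le _ _).trans ?_
  rw [← smul_sub, ← AddCircle.coe_sub, ← AddCircle.coe_zsmul, zsmul_eq_mul, ← abs_mul]
  gcongr
  exact norm_coe_le _

theorem re_fourier_coe (m : ℤ) (r : ℝ) :
    (fourier m (r : UnitAddCircle)).re = Real.cos (2 * Real.pi * (m * r)) := by
  rw [fourier_apply, ← AddCircle.coe_zsmul, AddCircle.toCircle_apply_mk, Circle.coe_exp,
    Complex.exp_ofReal_mul_I_re, div_one, zsmul_eq_mul]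

/-- The limit profile `u ↦ exp(-8πi m t cos(2πu))` of the orbital sums. -/
noncomputable def limitProfile (t : ℝ) (m : ℤ) : C(UnitAddCircle, ℂ) where
  toFun u := fourier m ((-(4 * t * (fourier 1 u).re) : ℝ) : UnitAddCircle)
  continuous_toFun := (fourier m).continuous.comp ((AddCircle.continuous_mk' 1).comp
    (continuous_const.mul (Complex.continuous_re.comp (fourier 1).continuous)).neg)

theorem limitProfile_apply (t : ℝ) (m : ℤ) (u : UnitAddCircle) :
    limitProfile t m u = fourier m ((-(4 * t * (fourier 1 u).re) : ℝ) : UnitAddCircle) := rfl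

/-- A continuous function with values on the unit circle and mean `1` must be identically `1`, so
one point with another value is enough. -/
theorem integral_limitProfile_ne_one {t : ℝ} (ht : 0 < t) {m : ℤ} (hm : m ≠ 0) :
    ∫ u, limitProfile t m u ∂haarAddCircle ≠ 1 := by
  intro h
  have hm' : 0 < |(m : ℝ)| := abs_pos.mpr (by exact_mod_cast hm)
  -- A value of the cosine so small that the phase `4 m t s`, though nonzero, stays below `1` in
  -- absolute value and is not an integer.
  set s : ℝ := 1 / (8 * |(m : ℝ)| * t + 1) with hs
  have hden : 0 < 8 * |(m : ℝ)| * t + 1 := by positivity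
  have hs0 : 0 < s := by positivity
  have hs1 : s ≤ 1 := by
    rw [hs, div_le_one hden]
    have : 0 < 8 * |(m : ℝ)| * t := by positivity
    linarith
  let u : UnitAddCircle := ((Real.arccos s / (2 * Real.pi) : ℝ) : UnitAddCircle)
  have hu : (fourier 1 u).re = s := by
    rw [re_fourier_coe, Int.cast_one, one_mul, mul_div_cancel₀ _ (by positivity),
      Real.cos_arccos (by linarith) hs1]
  have hre : ∀ v, (limitProfile t m v).re ≤ 1 := fun v =>
    (Complex.re_le_norm _).trans (norm_fourier_apply _ _).le
  have hlt : (limitProfile t m u).re ≠ 1 := by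
    rw [limitProfile_apply, hu, re_fourier_coe]
    have h1 : |(m : ℝ) * -(4 * t * s)| < 1 := by
      rw [abs_mul, abs_neg, abs_of_pos (by positivity : 0 < 4 * t * s), hs,
        show |(m : ℝ)| * (4 * t * (1 / (8 * |(m : ℝ)| * t + 1))) =
          4 * |(m : ℝ)| * t / (8 * |(m : ℝ)| * t + 1) by ring, div_lt_one hden]
      have : 0 < |(m : ℝ)| * t := by positivity
      linarith
    rw [abs_lt] at h1
    have hpi := Real.pi_pos
    rw [Ne, Real.cos_eq_one_iff_of_lt_of_lt (by nlinarith) (by nlinarith)]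
    have : (m : ℝ) ≠ 0 := by exact_mod_cast hm
    have hne : 4 * t * s ≠ 0 := by positivity
    have hpi' : (2 * Real.pi) ≠ 0 := by positivity
    exact mul_ne_zero hpi' (mul_ne_zero this (neg_ne_zero.mpr hne))
  have hint : Integrable (limitProfile t m) haarAddCircle :=
    (limitProfile t m).continuous.integrable_of_hasCompactSupport
      (HasCompactSupport.of_compactSpace _)
  have hzero : ∫ v, (1 - (limitProfile t m v).re) ∂haarAddCircle = 0 := by
    have hre' : ∫ v, (limitProfile t m v).re ∂haarAddCircle = 1 := by
      have := integral_re hint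
      rw [h] at this
      simpa using this
    have hint' : Integrable (fun v => (limitProfile t m v).re) haarAddCircle := hint.re
    rw [integral_sub (integrable_const _) hint', hre']
    simp
  have hcont : Continuous fun v => 1 - (limitProfile t m v).re :=
    continuous_const.sub (Complex.continuous_re.comp (limitProfile t m).continuous)
  have hpos := hcont.integral_pos_of_hasCompactSupport_nonneg_nonzero (μ := haarAddCircle)
    (HasCompactSupport.of_compactSpace _) (fun v => sub_nonneg.mpr (hre v))
    (x := u) (sub_ne_zero.mpr hlt.symm)
  exact hpos.ne' hzero

/-- At time `2^{n_K}` the flow hardly moves the base and moves the fibre by about `-4t cos(2π n_K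
x)`, since `c_K → 1`. Invariance and decoupling give `I = I ∫ limitProfile`, and the second factor
is not `1`. -/
theorem integral_torusCharacter_eq_zero {t C : ℝ} {c : ℕ → ℝ} (hc : ∀ k, |c k| ≤ C) (ht0 : 0 < t)
    (ht1 : t ≤ 1) (hlim : Tendsto c atTop (𝓝 1))
    (hμ : MeasurePreserving (skew (cocycle t c)) μ μ) (j : ℤ) {m : ℤ} (hm : m ≠ 0) :
    ∫ p, torusCharacter j m p ∂μ = 0 := by
  set I := ∫ p, torusCharacter j m p ∂μ with hI
  let q : ℕ → ℕ := fun K => returnTime K K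
  have hpow : Tendsto (fun K : ℕ => (1 : ℝ) / 2 ^ K) atTop (𝓝 0) := by
    simpa [one_div_pow] using tendsto_pow_atTop_nhds_zero_of_lt_one (r := (1 / 2 : ℝ))
      (by norm_num) (by norm_num)
  let δ : ℕ → ℝ := fun K => 2 * Real.pi * (|(j : ℝ)| * (2 * (1 / 2 ^ K))) +
    2 * Real.pi * (|(m : ℝ)| * (16 * Real.pi * C * (1 / 2 ^ K) + 4 * t * |c K - 1|))
  have hδ : Tendsto δ atTop (𝓝 0) := by
    have h1 : Tendsto (fun K => |c K - 1|) atTop (𝓝 0) := by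
      simpa using (hlim.sub_const 1).abs
    have h2 := ((((hpow.const_mul 2).const_mul |(j : ℝ)|).const_mul (2 * Real.pi))).add
      ((((hpow.const_mul (16 * Real.pi * C)).add (h1.const_mul (4 * t))).const_mul
        |(m : ℝ)|).const_mul (2 * Real.pi))
    simpa only [mul_zero, add_zero] using h2
  have hclose : ∀ K, ‖I - ∫ p, torusCharacter j m p * limitProfile t m (frequency K • p.1) ∂μ‖ ≤
      δ K := by
    intro K
    rw [hI, ← integral_comp_iterate hμ (q K) (torusCharacter j m).continuous.measurable,
      ← integral_sub]
    · refine (norm_integral_le_of_norm_le_const (C := δ K) (.of_forall fun p => ?_)).trans (by simp)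
      have h1 : limitProfile t m (frequency K • p.1) = fourier m
          ((-(4 * t * (fourier (frequency K) p.1).re) : ℝ) : UnitAddCircle) := by
        rw [limitProfile_apply, fourier_apply (n := 1), fourier_apply (n := (frequency K : ℤ)),
          one_smul, natCast_zsmul]
      have h2 := abs_rotationSum_cocycle_add_le hc ht0.le ht1 K K p.1
      rw [Finset.Icc_self, Finset.sum_singleton] at h2
      set S := rotationSum (cocycle t c) (q K) p.1 with hS
      set R := (fourier (frequency K) p.1).re with hR
      have hR1 : |R| ≤ 1 := (Complex.abs_re_le_norm _).trans (norm_fourier_apply _ _).le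
      have h3 : |S - -(4 * t * R)| ≤ 16 * Real.pi * C * (1 / 2 ^ K) + 4 * t * |c K - 1| := by
        have h4 : S - -(4 * t * R) = (S + 4 * t * (c K * R)) - 4 * t * (c K - 1) * R := by ring
        rw [h4]
        refine (abs_sub _ _).trans (add_le_add ?_ ?_)
        · refine h2.trans (le_of_eq ?_)
          ring
        · rw [abs_mul, abs_mul, abs_of_pos (by positivity : 0 < 4 * t)]
          exact mul_le_of_le_one_right (by positivity) hR1
      have h5 : ‖fourier j (q K • alphaCircle) - 1‖ ≤
          2 * Real.pi * (|(j : ℝ)| * (2 * (1 / 2 ^ K))) := by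
        rw [fourier_apply]
        refine (norm_toCircle_sub_one_le _).trans ?_
        gcongr
        refine (norm_zsmul_le _ _).trans ?_
        rw [Int.norm_eq_abs]
        gcongr
        exact (norm_returnTime_nsmul_le K K).trans (le_of_eq (by ring))
      have h6 : ‖fourier m (S : UnitAddCircle) -
          fourier m ((-(4 * t * R) : ℝ) : UnitAddCircle)‖ ≤
          2 * Real.pi * (|(m : ℝ)| * (16 * Real.pi * C * (1 / 2 ^ K) + 4 * t * |c K - 1|)) := by
        refine (norm_fourier_coe_sub_le m _ _).trans ?_
        gcongr
      rw [h1, skew_iterate, torusCharacter_apply, fourier_add_arg, fourier_add_arg,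
        torusCharacter_apply]
      have h7 : fourier j p.1 * fourier j (q K • alphaCircle) *
          (fourier m p.2 * fourier m (S : UnitAddCircle)) - fourier j p.1 * fourier m p.2 *
            fourier m ((-(4 * t * R) : ℝ) : UnitAddCircle) =
          fourier j p.1 * fourier m p.2 * ((fourier j (q K • alphaCircle) - 1) *
            fourier m (S : UnitAddCircle) + (fourier m (S : UnitAddCircle) -
              fourier m ((-(4 * t * R) : ℝ) : UnitAddCircle))) := by ring
      rw [h7, norm_mul, norm_mul, norm_fourier_apply, norm_fourier_apply, one_mul, one_mul]
      refine norm_add_le_of_le ?_ h6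
      rw [norm_mul, norm_fourier_apply, mul_one]
      exact h5
    · exact ((torusCharacter j m).continuous.comp
        ((skew (cocycle t c)).continuous.iterate _)).integrable_of_hasCompactSupport
          (HasCompactSupport.of_compactSpace _)
    · exact ((torusCharacter j m).continuous.mul ((limitProfile t m).continuous.comp
        ((continuous_nsmul _).comp continuous_fst))).integrable_of_hasCompactSupport
          (HasCompactSupport.of_compactSpace _)
  have h1 : Tendsto (fun K => ∫ p, torusCharacter j m p * limitProfile t m (frequency K • p.1) ∂μ)
      atTop (𝓝 I) := by
    have := (squeeze_zero_norm hclose hδ).const_sub I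
    simpa using this
  have h2 := tendsto_nhds_unique h1
    (tendsto_integral_torusCharacter_mul hμ j m (limitProfile t m))
  have h3 : (1 - ∫ u, limitProfile t m u ∂haarAddCircle) * I = 0 := by
    rw [sub_mul, one_mul, ← h2, sub_self]
  rcases mul_eq_zero.mp h3 with h4 | h4
  · exact absurd (sub_eq_zero.mp h4).symm (integral_limitProfile_ne_one ht0 hm)
  · exact h4

theorem isStrictlyErgodic_skew_cocycle {t C : ℝ} {c : ℕ → ℝ} (hc : ∀ k, |c k| ≤ C) (ht0 : 0 < t)
    (ht1 : t ≤ 1) (hlim : Tendsto c atTop (𝓝 1)) : IsStrictlyErgodic (skew (cocycle t c)) := by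
  have h : IsUniquelyErgodic (skew (cocycle t c)) := by
    refine isUniquelyErgodic_skew_of_integral_torusCharacter _ fun μ _ hμ j m hjm => ?_
    by_cases hm : m = 0
    · subst hm
      exact integral_torusCharacter_base hμ fun h => hjm (by rw [h])
    · exact integral_torusCharacter_eq_zero hc ht0 ht1 hlim hμ j hm
  exact ⟨h.isMinimal torusMeasure (measurePreserving_skew _), h⟩

end UniqueErgodicity

/-! ### A minimal skew product that is not uniquely ergodic -/

section Coboundary

open AddCircle

/-- The first partial sum exceeding `r` overshoots by no more than its last term. -/
theorem exists_partial_sum_near {a : ℕ → ℝ} (hdiv : Tendsto (fun n => ∑ i ∈ Finset.range n, a i)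
    atTop atTop) {r ε : ℝ} (hr : 0 ≤ r) (hsmall : ∀ i, a i < ε) :
    ∃ n, |∑ i ∈ Finset.range (n + 1), a i - r| < ε := by
  classical
  have hex : ∃ n, r < ∑ i ∈ Finset.range (n + 1), a i :=
    ((tendsto_add_atTop_nat 1).eventually (hdiv.eventually_gt_atTop r)).exists
  refine ⟨Nat.find hex, ?_⟩
  have h1 := Nat.find_spec hex
  have h2 : ∑ i ∈ Finset.range (Nat.find hex), a i ≤ r := by
    rcases Nat.eq_zero_or_pos (Nat.find hex) with h | h
    · rw [h, Finset.sum_range_zero]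
      exact hr
    · have h3 := Nat.find_min hex (Nat.sub_one_lt h.ne')
      rwa [Nat.sub_one_add_one h.ne', not_lt] at h3
  have h3 := Finset.sum_range_succ a (Nat.find hex)
  have h4 := hsmall (Nat.find hex)
  rw [abs_lt]
  constructor <;> linarith

/-- Over `x = 0` all cosines equal `1`, so the sums at return times are about `-4t ∑_{K ≤ k ≤ L}
c_k`. Small steps and divergence bring them close to any prescribed nonpositive number. -/
theorem isMinimal_skew_cocycle {t C : ℝ} {c : ℕ → ℝ} (hc : ∀ k, |c k| ≤ C) (ht0 : 0 < t)
    (ht1 : t ≤ 1) (hlim : Tendsto c atTop (𝓝 0))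
    (hdiv : Tendsto (fun n => ∑ k ∈ Finset.range n, c k) atTop atTop) :
    IsMinimal (skew (cocycle t c)) := by
  refine isMinimal_skew _ fun y ε hε => ?_
  obtain ⟨s, rfl⟩ : ∃ s : ℝ, (s : UnitAddCircle) = y := QuotientAddGroup.mk_surjective y
  -- The target is represented modulo `1` by `s - ⌈s⌉ ≤ 0`, to match the negative sign of the sums.
  have hr : 0 ≤ (⌈s⌉ : ℝ) - s := sub_nonneg.mpr (Int.le_ceil s)
  have hpow : Tendsto (fun K : ℕ => (1 : ℝ) / 2 ^ K) atTop (𝓝 0) := by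
    simpa [one_div_pow] using tendsto_pow_atTop_nhds_zero_of_lt_one (r := (1 / 2 : ℝ))
      (by norm_num) (by norm_num)
  have h1 : ∀ᶠ K : ℕ in atTop, 2 * (1 / 2 ^ K : ℝ) < ε := by
    have := hpow.const_mul 2
    rw [mul_zero] at this
    exact this.eventually_lt_const hε
  have h2 : ∀ᶠ K : ℕ in atTop, 16 * Real.pi * C * (1 / 2 ^ K : ℝ) < ε / 2 := by
    have := hpow.const_mul (16 * Real.pi * C)
    rw [mul_zero] at this
    exact this.eventually_lt_const (by positivity)
  have h3 : ∀ᶠ K : ℕ in atTop, 4 * t * c K < ε / 2 := by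
    have := hlim.const_mul (4 * t)
    rw [mul_zero] at this
    exact this.eventually_lt_const (by positivity)
  obtain ⟨K, hK⟩ := eventually_atTop.mp (h1.and (h2.and h3))
  have hdivK : Tendsto (fun n => ∑ i ∈ Finset.range n, 4 * t * c (K + i)) atTop atTop := by
    have h4 : ∀ n, ∑ i ∈ Finset.range n, 4 * t * c (K + i) =
        4 * t * (∑ k ∈ Finset.range (n + K), c k + -∑ k ∈ Finset.range K, c k) := fun n => by
      rw [← Finset.mul_sum, add_comm n K, Finset.sum_range_add]
      ring
    simp only [h4]
    exact (tendsto_atTop_add_const_right _ _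
      (hdiv.comp (tendsto_add_atTop_nat K))).const_mul_atTop (by positivity)
  obtain ⟨n, hn⟩ := exists_partial_sum_near hdivK hr fun i => (hK (K + i) (by omega)).2.2
  refine ⟨returnTime K (K + n), ?_, ?_⟩
  · refine (norm_returnTime_nsmul_le K (K + n)).trans_lt ?_
    rw [← mul_one_div]
    exact (hK K le_rfl).1
  · have h4 := abs_rotationSum_cocycle_add_le hc ht0.le ht1 K (K + n) 0
    have h5 : 4 * t * ∑ k ∈ Finset.Icc K (K + n), c k * (fourier (frequency k) (0 : UnitAddCircle)).re =
        ∑ i ∈ Finset.range (n + 1), 4 * t * c (K + i) := by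
      simp only [fourier_eval_zero, Complex.one_re, mul_one]
      rw [← Finset.Ico_add_one_right_eq_Icc, Finset.sum_Ico_eq_sum_range, Finset.mul_sum]
      congr 2
      omega
    rw [h5] at h4
    set S := rotationSum (cocycle t c) (returnTime K (K + n)) 0
    set Q := ∑ i ∈ Finset.range (n + 1), 4 * t * c (K + i)
    have h6 : ((⌈s⌉ : ℝ) : UnitAddCircle) = 0 := by
      rw [AddCircle.coe_eq_zero_iff]
      exact ⟨⌈s⌉, by simp⟩
    have h7 : (S : UnitAddCircle) - (s : UnitAddCircle) =
        ((S + (⌈s⌉ - s) : ℝ) : UnitAddCircle) := by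
      rw [AddCircle.coe_add, AddCircle.coe_sub, h6]
      abel
    rw [h7]
    refine (norm_coe_le _).trans_lt ?_
    calc |S + (⌈s⌉ - s)| = |(S + Q) - (Q - (⌈s⌉ - s))| := by congr 1; ring
      _ ≤ |S + Q| + |Q - (⌈s⌉ - s)| := abs_sub _ _
      _ < ε / 2 + ε / 2 := by
          refine add_lt_add (h4.trans_lt ?_) hn
          rw [← mul_one_div]
          exact (hK K le_rfl).2.1
      _ = ε := by ring

/-- If the coefficients are square summable, the cocycle is the coboundary of an integrable
function. -/
theorem exists_transfer_function {c : ℕ → ℝ} {C : ℝ} (hc : ∀ k, |c k| ≤ C)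
    (hsq : Summable fun k => c k ^ 2) :
    ∃ Θ : UnitAddCircle → ℝ, Measurable Θ ∧ Integrable Θ haarAddCircle ∧
      ∀ᵐ x ∂haarAddCircle, Θ (x + alphaCircle) - Θ x = 2 * (analyticSeries c x).re := by
  have hinj : Function.Injective fun k : ℕ => (frequency k : ℤ) :=
    Nat.cast_injective.comp frequency_strictMono.injective
  have hon : Orthonormal ℂ fun k : ℕ => fourierLp (T := 1) 2 (frequency k) :=
    orthonormal_fourier.comp _ hinj
  have hsum : Summable fun k : ℕ => (c k : ℂ) • fourierLp (T := 1) 2 (frequency k) := by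
    have h1 := hon.orthogonalFamily.summable_iff_norm_sq_summable fun k => (c k : ℂ)
    refine h1.mpr ?_
    simpa using hsq
  let F := ∑' k : ℕ, (c k : ℂ) • fourierLp (T := 1) 2 (frequency k)
  have hrot : MeasurePreserving (fun x : UnitAddCircle => x + alphaCircle) haarAddCircle
      haarAddCircle := measurePreserving_add_right _ _
  let R := Lp.compMeasurePreservingₗᵢ (E := ℂ) (p := 2) ℂ _ hrot
  have hR : ∀ n : ℤ, R (fourierLp 2 n) = fourier n alphaCircle • fourierLp 2 n := by
    intro n
    refine Lp.ext ?_
    have h1 : R (fourierLp 2 n) =ᵐ[haarAddCircle] _ :=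
      Lp.coeFn_compMeasurePreserving (fourierLp 2 n) hrot
    have h2 := hrot.quasiMeasurePreserving.ae_eq_comp (coeFn_fourierLp (T := 1) 2 n)
    have h3 := Lp.coeFn_smul (fourier n alphaCircle) (fourierLp (T := 1) 2 n)
    filter_upwards [h1, h2, h3, coeFn_fourierLp (T := 1) 2 n] with x h1 h2 h3 h4
    rw [h1, h2, h3, Pi.smul_apply, h4, Function.comp_apply, fourier_add_arg, smul_eq_mul, mul_comm]
  -- Rotation multiplies the `k`-th term of `F` by `e(n_k α)`; the formal coboundary identity
  -- becomes true in `L²`.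
  have hcob : R F - F = ContinuousMap.toLp 2 haarAddCircle ℂ (analyticSeries c) := by
    have h1 := (hsum.hasSum.map R R.continuous).sub hsum.hasSum
    have h2 := (hasSum_seriesTerm hc).map (ContinuousMap.toLp (E := ℂ) 2 haarAddCircle ℂ)
      (ContinuousMap.toLp (E := ℂ) 2 haarAddCircle ℂ).continuous
    refine h1.unique ?_
    convert h2 using 1
    funext k
    simp only [Function.comp_apply, map_smul, hR, seriesTerm]
    rw [mul_smul, sub_smul, one_smul, smul_sub]
  have hae : ∀ᵐ x ∂haarAddCircle, F (x + alphaCircle) - F x = analyticSeries c x := by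
    have h1 : R F =ᵐ[haarAddCircle] _ := Lp.coeFn_compMeasurePreserving F hrot
    have h2 := Lp.coeFn_sub (R F) F
    rw [hcob] at h2
    filter_upwards [h1, h2, ContinuousMap.coeFn_toLp (p := 2) (𝕜 := ℂ) haarAddCircle
      (analyticSeries c)] with x h1 h2 h3
    rw [← h3, h2, Pi.sub_apply, h1]
    rfl
  have hint : Integrable F haarAddCircle := (Lp.memLp F).integrable one_le_two
  refine ⟨fun x => 2 * (F x).re, ?_, ?_, ?_⟩
  · exact (Complex.measurable_re.comp (Lp.stronglyMeasurable F).measurable).const_mul 2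
  · exact Integrable.const_mul hint.re 2
  · filter_upwards [hae] with x hx
    rw [← hx, Complex.sub_re]
    ring

/-- The measure on the graph of `θ`, shifted vertically by `s`. -/
noncomputable def graphMeasure (θ : UnitAddCircle → ℝ) (s : UnitAddCircle) :
    Measure (UnitAddCircle × UnitAddCircle) :=
  haarAddCircle.map fun x => (x, (θ x : UnitAddCircle) + s)

variable {θ : UnitAddCircle → ℝ}

theorem measurable_graph (hθ : Measurable θ) (s : UnitAddCircle) :
    Measurable fun x => (x, (θ x : UnitAddCircle) + s) :=
  measurable_id.prodMk (((AddCircle.continuous_mk' 1).measurable.comp hθ).add_const s)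

theorem isProbabilityMeasure_graphMeasure (hθ : Measurable θ) (s : UnitAddCircle) :
    IsProbabilityMeasure (graphMeasure θ s) :=
  Measure.isProbabilityMeasure_map (measurable_graph hθ s).aemeasurable

/-- Almost everywhere `θ(x) + φ(x) = θ(x + α)`, so the flow acts on the shifted graph as the
rotation acts on the base. -/
theorem measurePreserving_graphMeasure (hθ : Measurable θ) (s : UnitAddCircle)
    {φ : C(UnitAddCircle, ℝ)}
    (hφ : ∀ᵐ x ∂haarAddCircle, θ (x + alphaCircle) - θ x = φ x) :
    MeasurePreserving (skew φ) (graphMeasure θ s) (graphMeasure θ s) := by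
  have hrot : MeasurePreserving (fun x : UnitAddCircle => x + alphaCircle) haarAddCircle
      haarAddCircle := measurePreserving_add_right _ _
  refine ⟨(skew φ).continuous.measurable, ?_⟩
  rw [graphMeasure, Measure.map_map (skew φ).continuous.measurable (measurable_graph hθ s)]
  conv_rhs => rw [← hrot.map_eq, Measure.map_map (measurable_graph hθ s) hrot.measurable]
  refine Measure.map_congr ?_
  filter_upwards [hφ] with x hx
  simp only [Function.comp_apply, skew_apply]
  rw [← hx, AddCircle.coe_sub]
  congr 1
  abel

/-- The real part of the exponential of the second coordinate. -/
noncomputable def verticalCosine : C(UnitAddCircle × UnitAddCircle, ℝ) where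
  toFun p := (toCircle p.2 : ℂ).re
  continuous_toFun := Complex.continuous_re.comp
    (continuous_subtype_val.comp (continuous_toCircle.comp continuous_snd))

theorem integral_verticalCosine_graphMeasure (hθ : Measurable θ) (s : UnitAddCircle) :
    ∫ p, verticalCosine p ∂(graphMeasure θ s) =
      ∫ x, (toCircle ((θ x : UnitAddCircle) + s) : ℂ).re ∂haarAddCircle := by
  rw [graphMeasure, integral_map (measurable_graph hθ s).aemeasurable
    verticalCosine.continuous.measurable.aestronglyMeasurable]
  rfl

theorem integral_verticalCosine_graphMeasure_half (hθ : Measurable θ) :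
    ∫ p, verticalCosine p ∂(graphMeasure θ ((1 / 2 : ℝ) : UnitAddCircle)) =
      -∫ p, verticalCosine p ∂(graphMeasure θ 0) := by
  rw [integral_verticalCosine_graphMeasure hθ, integral_verticalCosine_graphMeasure hθ,
    ← integral_neg]
  refine integral_congr_ae (.of_forall fun x => ?_)
  simp only [toCircle_add, Circle.coe_mul, toCircle_coe_half, add_zero]
  simp

/-- The bound `cos(2πtΘ) ≥ 1 - 2πt|Θ|` leaves a positive integral once `2πt ∫|Θ| < 1`. -/
theorem exists_pos_integral_verticalCosine {Θ : UnitAddCircle → ℝ} (hΘ : Measurable Θ)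
    (hint : Integrable Θ haarAddCircle) :
    ∃ t : ℝ, 0 < t ∧ t ≤ 1 ∧
      0 < ∫ p, verticalCosine p ∂(graphMeasure (fun x => t * Θ x) 0) := by
  set B := ∫ x, |Θ x| ∂haarAddCircle with hB
  have hB0 : 0 ≤ B := integral_nonneg fun x => abs_nonneg _
  have hden : 0 < 2 * Real.pi * B + 1 := by positivity
  refine ⟨1 / (2 * Real.pi * B + 1), by positivity, ?_, ?_⟩
  · rw [div_le_one hden]
    have : 0 ≤ 2 * Real.pi * B := by positivity
    linarith
  set t := 1 / (2 * Real.pi * B + 1) with ht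
  have ht0 : 0 < t := by positivity
  have htΘ : Measurable fun x => t * Θ x := hΘ.const_mul t
  rw [integral_verticalCosine_graphMeasure htΘ]
  have hlower : ∀ x, 1 - 2 * Real.pi * t * |Θ x| ≤
      (toCircle (((t * Θ x : ℝ) : UnitAddCircle) + 0) : ℂ).re := by
    intro x
    rw [add_zero]
    have h1 := norm_toCircle_sub_one_le ((t * Θ x : ℝ) : UnitAddCircle)
    have h2 := (Complex.abs_re_le_norm _).trans h1
    rw [Complex.sub_re, Complex.one_re] at h2
    have h3 := norm_coe_le (t * Θ x)
    rw [abs_mul, abs_of_pos ht0] at h3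
    have h4 : 2 * Real.pi * ‖((t * Θ x : ℝ) : UnitAddCircle)‖ ≤ 2 * Real.pi * (t * |Θ x|) := by
      gcongr
    have h5 := (abs_le.mp h2).1
    linarith
  have hint2 : Integrable (fun x => (toCircle (((t * Θ x : ℝ) : UnitAddCircle) + 0) : ℂ).re)
      haarAddCircle := by
    refine Integrable.of_bound (C := 1) ?_ (.of_forall fun x => ?_)
    · exact (verticalCosine.continuous.measurable.comp
        (measurable_graph htΘ 0)).aestronglyMeasurable
    · exact (Complex.abs_re_le_norm _).trans (Circle.norm_coe _).le
  have h1 := integral_mono ((integrable_const 1).sub (hint.abs.const_mul (2 * Real.pi * t)))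
    hint2 hlower
  refine lt_of_lt_of_le ?_ h1
  simp only [Pi.sub_apply]
  rw [integral_sub (integrable_const 1) (hint.abs.const_mul (2 * Real.pi * t)), integral_const_mul,
    ← hB]
  simp only [integral_const, probReal_univ, smul_eq_mul, mul_one, sub_pos]
  rw [ht, show 2 * Real.pi * (1 / (2 * Real.pi * B + 1)) * B =
    2 * Real.pi * B / (2 * Real.pi * B + 1) by ring, div_lt_one hden]
  linarith

end Coboundary

/-! ### Functions that are not strictly ergodic -/

section NotStrictlyErgodic

/-- A sequence read off a flow along a dense orbit cannot come from a uniquely ergodic flow if two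
invariant measures of the flow give different integrals. -/
theorem not_isUniquelyErgodic_of_two_integrals {Y : Type*} [TopologicalSpace Y] [CompactSpace Y]
    [MeasurableSpace Y] [BorelSpace Y] {T : Y ≃ₜ Y} {y₀ : Y}
    (hy₀ : Dense (range fun n : ℤ => (T ^ n) y₀)) (ψ : C(Y, ℝ)) {μ ν : Measure Y}
    [IsProbabilityMeasure μ] [IsProbabilityMeasure ν] (hμ : MeasurePreserving T μ μ)
    (hν : MeasurePreserving T ν ν) (hlt : ∫ y, ψ y ∂ν < ∫ y, ψ y ∂μ)
    {X : Type*} [TopologicalSpace X] [CompactSpace X] [T2Space X] [MeasurableSpace X]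
    [BorelSpace X] {S : X ≃ₜ X} {x₀ : X} (G : C(X, ℝ))
    (hG : ∀ n : ℤ, G ((S ^ n) x₀) = ψ ((T ^ n) y₀)) : ¬ IsUniquelyErgodic S := by
  intro hS
  have havg : ∀ (N : ℕ) (k : ℤ), birkhoffAverage ℝ S G (N + 1) ((S ^ k) x₀) =
      birkhoffAverage ℝ T ψ (N + 1) ((T ^ k) y₀) := by
    intro N k
    simp only [birkhoffAverage, birkhoffSum]
    congr 1
    refine Finset.sum_congr rfl fun n _ => ?_
    rw [← zpow_natCast_apply_eq_iterate, ← zpow_natCast_apply_eq_iterate, ← zpow_add_apply,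
      ← zpow_add_apply, hG]
  have hcont : ∀ N : ℕ, Continuous fun y => birkhoffAverage ℝ T ψ (N + 1) y := fun N => by
    simp only [birkhoffAverage, birkhoffSum, smul_eq_mul]
    exact continuous_const.mul (continuous_finsetSum _ fun n _ =>
      ψ.continuous.comp (T.continuous.iterate n))
  have hint : ∀ (m : Measure Y) [IsProbabilityMeasure m] (f : Y → ℝ), Continuous f →
      Integrable f m := fun m _ f hf =>
    hf.integrable_of_hasCompactSupport (HasCompactSupport.of_compactSpace _)
  have hintegral : ∀ (m : Measure Y) [IsProbabilityMeasure m], MeasurePreserving T m m → ∀ N : ℕ,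
      ∫ y, birkhoffAverage ℝ T ψ (N + 1) y ∂m = ∫ y, ψ y ∂m := by
    intro m _ hm N
    have hi : ∀ n ∈ Finset.range (N + 1), Integrable (fun y => ψ (T^[n] y)) m := fun n _ =>
      hint m _ (ψ.continuous.comp (T.continuous.iterate n))
    simp only [birkhoffAverage, birkhoffSum]
    rw [integral_smul, integral_finsetSum _ hi]
    have h1 : ∀ n : ℕ, ∫ y, ψ (T^[n] y) ∂m = ∫ y, ψ y ∂m := fun n => by
      have hn := hm.iterate n
      conv_rhs => rw [← hn.map_eq]
      exact (integral_map hn.measurable.aemeasurable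
        ψ.continuous.measurable.aestronglyMeasurable).symm
    simp only [h1, Finset.sum_const, Finset.card_range, nsmul_eq_mul, smul_eq_mul]
    push_cast
    field_simp
  obtain ⟨b, hνb, hbμ⟩ := exists_between hlt
  obtain ⟨a, hba, haμ⟩ := exists_between hbμ
  -- Some point has an average at least its integral; exceeding `a` is an open condition, so the
  -- dense orbit of `y₀` meets it.
  have hupper : ∀ N : ℕ, ∃ k : ℤ, a < birkhoffAverage ℝ T ψ (N + 1) ((T ^ k) y₀) := by
    intro N
    obtain ⟨y, hy⟩ := exists_integral_le (hint μ _ (hcont N))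
    rw [hintegral μ hμ] at hy
    obtain ⟨_, ⟨k, rfl⟩, hk⟩ := hy₀.exists_mem_open (isOpen_lt continuous_const (hcont N))
      ⟨y, haμ.trans_le hy⟩
    exact ⟨k, hk⟩
  have hlower : ∀ N : ℕ, ∃ k : ℤ, birkhoffAverage ℝ T ψ (N + 1) ((T ^ k) y₀) < b := by
    intro N
    obtain ⟨y, hy⟩ := exists_le_integral (hint ν _ (hcont N))
    rw [hintegral ν hν] at hy
    obtain ⟨_, ⟨k, rfl⟩, hk⟩ := hy₀.exists_mem_open (isOpen_lt (hcont N) continuous_const)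
      ⟨y, hy.trans_lt hνb⟩
    exact ⟨k, hk⟩
  choose k hk using hupper
  choose l hl using hlower
  have := hS.le_of_averages G (fun N => (S ^ k N) x₀) (fun N => (S ^ l N) x₀) a b
    (fun N => by rw [havg]; exact (hk N).le) (fun N => by rw [havg]; exact (hl N).le)
  linarith

end NotStrictlyErgodic

/-! ### The functions read off skew products -/

section SkewFunctions

open AddCircle

theorem skewFunction_apply (φ : C(UnitAddCircle, ℝ)) (n : ℤ) :
    skewFunction furstenbergAlpha φ n = toCircle ((skew φ ^ n) (0, 0)).2 := rfl

theorem comesFrom_skewFunction (φ : C(UnitAddCircle, ℝ)) :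
    ComesFrom (skewFunction furstenbergAlpha φ) (skew φ) :=
  ⟨⟨fun p => toCircle p.2, continuous_subtype_val.comp (continuous_toCircle.comp continuous_snd)⟩,
    (0, 0), fun _ => rfl⟩

theorem skewFunction_mem_distalFunctions {φ : C(UnitAddCircle, ℝ)} (h : IsMinimal (skew φ)) :
    skewFunction furstenbergAlpha φ ∈ distalFunctions :=
  ⟨_, inferInstance, inferInstance, inferInstance, skew φ, h, isDistal_skew φ,
    comesFrom_skewFunction φ⟩

theorem skewFunction_mem_strictlyErgodicDistalFunctions {φ : C(UnitAddCircle, ℝ)}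
    (h : IsStrictlyErgodic (skew φ)) :
    skewFunction furstenbergAlpha φ ∈ strictlyErgodicDistalFunctions :=
  ⟨skewFunction_mem_distalFunctions h.1, _, inferInstance, inferInstance, inferInstance,
    inferInstance, inferInstance, skew φ, h, comesFrom_skewFunction φ⟩

/-- Orbital sums over a common base orbit are additive in the cocycle; on exponentials this says
`E_{φ-χ} = E_φ · conj E_χ`. -/
theorem skew_sub_zpow (φ χ : C(UnitAddCircle, ℝ)) (n : ℤ) :
    ((skew (φ - χ) ^ n) (0, 0)).2 = ((skew φ ^ n) (0, 0)).2 - ((skew χ ^ n) (0, 0)).2 := by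
  have hfst : ∀ (φ : C(UnitAddCircle, ℝ)) (n : ℤ), ((skew φ ^ n) (0, 0)).1 = n • alphaCircle :=
    fun φ n => by
      obtain ⟨σ, hσ⟩ := exists_skew_zpow φ n
      rw [hσ, zero_add]
  have hsucc : ∀ (φ : C(UnitAddCircle, ℝ)) (n : ℤ), ((skew φ ^ (n + 1)) (0, 0)).2 =
      ((skew φ ^ n) (0, 0)).2 + (φ (n • alphaCircle) : UnitAddCircle) := fun φ n => by
    rw [add_comm, zpow_add_apply, zpow_one, skew_apply, hfst]
  have hstep : ∀ n : ℤ, ((skew (φ - χ) ^ (n + 1)) (0, 0)).2 -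
      (((skew φ ^ (n + 1)) (0, 0)).2 - ((skew χ ^ (n + 1)) (0, 0)).2) =
      ((skew (φ - χ) ^ n) (0, 0)).2 - (((skew φ ^ n) (0, 0)).2 - ((skew χ ^ n) (0, 0)).2) := by
    intro n
    rw [hsucc, hsucc, hsucc, ContinuousMap.sub_apply, AddCircle.coe_sub]
    abel
  rw [← sub_eq_zero]
  induction n using Int.induction_on with
  | zero => simp
  | succ n ih => rw [hstep, ih]
  | pred n ih =>
    have h := hstep (-(n : ℤ) - 1)
    rw [sub_add_cancel] at h
    rw [← h]
    exact ih

/-- The real part of `z * conj w` for points of the unit circle. -/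
theorem one_sub_norm_sub_sq_div_two (z w : Circle) :
    1 - ‖(z : ℂ) - w‖ ^ 2 / 2 = ((z / w : Circle) : ℂ).re := by
  have hz : (z : ℂ).re ^ 2 + (z : ℂ).im ^ 2 = 1 := by
    have := Circle.normSq_coe z
    rw [Complex.normSq_apply] at this
    linarith
  have hw : (w : ℂ).re ^ 2 + (w : ℂ).im ^ 2 = 1 := by
    have := Circle.normSq_coe w
    rw [Complex.normSq_apply] at this
    linarith
  have e : ((z / w : Circle) : ℂ) = (z : ℂ) * starRingEnd ℂ (w : ℂ) := by
    rw [← Circle.coe_inv_eq_conj, ← Circle.coe_mul, div_eq_mul_inv]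
  rw [e, ← Complex.normSq_eq_norm_sq,
    Complex.normSq_apply, Complex.mul_re, Complex.conj_re, Complex.conj_im, Complex.sub_re,
    Complex.sub_im]
  linear_combination (-1 / 2) * hz - (1 / 2) * hw

variable {θ : UnitAddCircle → ℝ} {φ : C(UnitAddCircle, ℝ)}

theorem not_isUniquelyErgodic_of_comesFrom (hθ : Measurable θ)
    (hφ : ∀ᵐ x ∂haarAddCircle, θ (x + alphaCircle) - θ x = φ x)
    (hpos : 0 < ∫ p, verticalCosine p ∂(graphMeasure θ 0)) (hmin : IsMinimal (skew φ))
    {X : Type*} [TopologicalSpace X] [CompactSpace X] [T2Space X] [MeasurableSpace X]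
    [BorelSpace X] {S : X ≃ₜ X} {x₀ : X} (G : C(X, ℝ))
    (hG : ∀ n : ℤ, G ((S ^ n) x₀) = (skewFunction furstenbergAlpha φ n).re) :
    ¬ IsUniquelyErgodic S := by
  have := isProbabilityMeasure_graphMeasure hθ 0
  have := isProbabilityMeasure_graphMeasure hθ ((1 / 2 : ℝ) : UnitAddCircle)
  refine not_isUniquelyErgodic_of_two_integrals (hmin (0, 0)) verticalCosine
    (measurePreserving_graphMeasure hθ 0 hφ)
    (measurePreserving_graphMeasure hθ ((1 / 2 : ℝ) : UnitAddCircle) hφ) ?_ G hG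
  rw [integral_verticalCosine_graphMeasure_half hθ]
  linarith

theorem skewFunction_notMem_strictlyErgodicFunctions (hθ : Measurable θ)
    (hφ : ∀ᵐ x ∂haarAddCircle, θ (x + alphaCircle) - θ x = φ x)
    (hpos : 0 < ∫ p, verticalCosine p ∂(graphMeasure θ 0)) (hmin : IsMinimal (skew φ)) :
    skewFunction furstenbergAlpha φ ∉ strictlyErgodicFunctions := by
  rintro ⟨X, _, _, _, _, _, T, hT, F, x₀, hF⟩
  refine not_isUniquelyErgodic_of_comesFrom hθ hφ hpos hmin
    ⟨fun x => (F x).re, Complex.continuous_re.comp F.continuous⟩ (x₀ := x₀) (fun n => ?_) hT.2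
  rw [hF]
  rfl

/-- If `F` represents `E_χ - E_η` on some flow, the continuous function `1 - |F|² / 2` represents
`Re E_φ` on the same flow, which rules out unique ergodicity. -/
theorem skewFunction_sub_notMem_strictlyErgodicFunctions {χ η : C(UnitAddCircle, ℝ)}
    (hχη : φ = χ - η) (hθ : Measurable θ)
    (hφ : ∀ᵐ x ∂haarAddCircle, θ (x + alphaCircle) - θ x = φ x)
    (hpos : 0 < ∫ p, verticalCosine p ∂(graphMeasure θ 0)) (hmin : IsMinimal (skew φ)) :
    skewFunction furstenbergAlpha χ - skewFunction furstenbergAlpha η ∉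
      strictlyErgodicFunctions := by
  rintro ⟨X, _, _, _, _, _, T, hT, F, x₀, hF⟩
  refine not_isUniquelyErgodic_of_comesFrom hθ hφ hpos hmin
    ⟨fun x => 1 - ‖F x‖ ^ 2 / 2, continuous_const.sub ((F.continuous.norm.pow 2).div_const 2)⟩
    (x₀ := x₀) (fun n => ?_) hT.2
  have e : ∀ a b : UnitAddCircle, toCircle (a - b) = toCircle a / toCircle b := fun a b => by
    rw [sub_eq_add_neg, toCircle_add, toCircle_neg, div_eq_mul_inv]
  rw [ContinuousMap.coe_mk, ← hF, skewFunction_apply, hχη, skew_sub_zpow, e,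
    ← one_sub_norm_sub_sq_div_two]
  rfl

theorem not_isUniquelyErgodic_skew (hθ : Measurable θ)
    (hφ : ∀ᵐ x ∂haarAddCircle, θ (x + alphaCircle) - θ x = φ x)
    (hpos : 0 < ∫ p, verticalCosine p ∂(graphMeasure θ 0)) (hmin : IsMinimal (skew φ)) :
    ¬ IsUniquelyErgodic (skew φ) :=
  not_isUniquelyErgodic_of_comesFrom hθ hφ hpos hmin verticalCosine (x₀ := (0, 0)) fun _ => rfl

/-- Furstenberg's example: two strictly ergodic skew products whose difference is minimal and
distal but not uniquely ergodic. -/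
theorem exists_furstenberg_example :
    ∃ t : ℝ, 0 ≤ t ∧ t ≤ 1 ∧ ∃ h g f : C(UnitAddCircle, ℝ),
      HasFurstenbergSeries t (fun _ => 1) h ∧
      HasFurstenbergSeries t (fun k => 1 + 1 / |(k : ℝ)|) g ∧
      HasFurstenbergSeries t (fun k => 1 / |(k : ℝ)|) f ∧ f = g - h ∧
      IsStrictlyErgodic (skew h) ∧ IsStrictlyErgodic (skew g) ∧ IsMinimal (skew f) ∧
      ¬ IsUniquelyErgodic (skew f) ∧
      skewFunction furstenbergAlpha f ∉ strictlyErgodicFunctions ∧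
      skewFunction furstenbergAlpha g - skewFunction furstenbergAlpha h ∉
        strictlyErgodicFunctions := by
  let a : ℕ → ℝ := fun k => 1 / ((k : ℝ) + 1)
  have ha0 : ∀ k, 0 ≤ a k := fun k => by positivity
  have ha1 : ∀ k, a k ≤ 1 := fun k => by
    rw [div_le_one (by positivity)]
    simp
  have hlim : Tendsto a atTop (𝓝 0) := tendsto_one_div_add_atTop_nhds_zero_nat
  have hh : ∀ _ : ℕ, |(1 : ℝ)| ≤ 2 := fun _ => by norm_num
  have hg : ∀ k, |1 + a k| ≤ 2 := fun k => by
    rw [abs_of_nonneg (by linarith [ha0 k])]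
    linarith [ha1 k]
  have hf : ∀ k, |a k| ≤ 2 := fun k => by
    rw [abs_of_nonneg (ha0 k)]
    linarith [ha1 k]
  have habs : ∀ k : ℕ, 1 / |(((k : ℤ) + 1 : ℤ) : ℝ)| = a k := fun k => by
    push_cast
    rw [abs_of_pos (by positivity)]
  have habs' : ∀ k : ℕ, 1 / |((-((k : ℤ) + 1) : ℤ) : ℝ)| = a k := fun k => by
    push_cast
    rw [← abs_neg, neg_neg, abs_of_pos (by positivity)]
  have hsq : Summable fun k => a k ^ 2 := by
    have h1 := (summable_nat_add_iff 1).mpr (Real.summable_one_div_nat_pow.mpr one_lt_two)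
    simpa [a, div_pow] using h1
  have hdiv : Tendsto (fun n => ∑ k ∈ Finset.range n, a k) atTop atTop :=
    Real.tendsto_sum_range_one_div_nat_succ_atTop
  obtain ⟨Θ, hΘ, hint, hae⟩ := exists_transfer_function hf hsq
  -- The amplitude is dictated by `f` alone; `h` and `g` need only `0 < t ≤ 1`.
  obtain ⟨t, ht0, ht1, hpos⟩ := exists_pos_integral_verticalCosine hΘ hint
  have hθ : Measurable fun x => t * Θ x := hΘ.const_mul t
  have hφ : ∀ᵐ x ∂haarAddCircle, t * Θ (x + alphaCircle) - t * Θ x = cocycle t a x := by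
    filter_upwards [hae] with x hx
    rw [← mul_sub, hx, cocycle_apply]
  have hmin := isMinimal_skew_cocycle hf ht0 ht1 hlim hdiv
  have hsub : cocycle t a = cocycle t (fun k => 1 + a k) - cocycle t fun _ => 1 := by
    rw [← cocycle_sub hg hh]
    simp only [add_sub_cancel_left]
  refine ⟨t, ht0.le, ht1, cocycle t fun _ => 1, cocycle t fun k => 1 + a k, cocycle t a,
    hasFurstenbergSeries_cocycle hh t (fun _ => rfl) (fun _ => rfl),
    hasFurstenbergSeries_cocycle hg t (fun k => by rw [habs]) (fun k => by rw [habs']),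
    hasFurstenbergSeries_cocycle hf t habs habs', hsub,
    isStrictlyErgodic_skew_cocycle hh ht0 ht1 tendsto_const_nhds,
    isStrictlyErgodic_skew_cocycle hg ht0 ht1 (by simpa using hlim.const_add 1), hmin,
    not_isUniquelyErgodic_skew hθ hφ hpos hmin,
    skewFunction_notMem_strictlyErgodicFunctions hθ hφ hpos hmin,
    skewFunction_sub_notMem_strictlyErgodicFunctions hsub hθ hφ hpos hmin⟩

end SkewFunctions

end ZFlow

theorem mainTheorem7 :
    -- the family is not closed under subtraction; the difference even fails to be strictly ergodic
    (∃ u ∈ ZFlow.strictlyErgodicDistalFunctions, ∃ w ∈ ZFlow.strictlyErgodicDistalFunctions,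
      u - w ∉ ZFlow.strictlyErgodicFunctions) ∧
    -- it is neither a subalgebra nor a vector subspace
    (¬ ∃ A : Subalgebra ℂ ℓ^∞(ℤ, ℂ),
      (A : Set ℓ^∞(ℤ, ℂ)) = ZFlow.strictlyErgodicDistalFunctions) ∧
    (¬ ∃ V : Submodule ℂ ℓ^∞(ℤ, ℂ),
      (V : Set ℓ^∞(ℤ, ℂ)) = ZFlow.strictlyErgodicDistalFunctions) ∧
    -- it strictly contains the Weyl algebra
    (ZFlow.weylAlgebra : Set ℓ^∞(ℤ, ℂ)) ⊂ ZFlow.strictlyErgodicDistalFunctions ∧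
    -- the example: the cocycle `f = g - h`
    ∃ t : ℝ, 0 ≤ t ∧ t ≤ 1 ∧ ∃ h g f : C(UnitAddCircle, ℝ),
      ZFlow.HasFurstenbergSeries t (fun _ => 1) h ∧
      ZFlow.HasFurstenbergSeries t (fun k => 1 + 1 / |(k : ℝ)|) g ∧
      ZFlow.HasFurstenbergSeries t (fun k => 1 / |(k : ℝ)|) f ∧
      f = g - h ∧
      -- the three flows on the two-torus
      (ZFlow.IsDistal (ZFlow.skewProduct ZFlow.furstenbergAlpha h) ∧
        ZFlow.IsStrictlyErgodic (ZFlow.skewProduct ZFlow.furstenbergAlpha h)) ∧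
      (ZFlow.IsDistal (ZFlow.skewProduct ZFlow.furstenbergAlpha g) ∧
        ZFlow.IsStrictlyErgodic (ZFlow.skewProduct ZFlow.furstenbergAlpha g)) ∧
      (ZFlow.IsDistal (ZFlow.skewProduct ZFlow.furstenbergAlpha f) ∧
        ZFlow.IsMinimal (ZFlow.skewProduct ZFlow.furstenbergAlpha f) ∧
        ¬ ZFlow.IsUniquelyErgodic (ZFlow.skewProduct ZFlow.furstenbergAlpha f)) ∧
      -- the associated functions on the integers
      ZFlow.skewFunction ZFlow.furstenbergAlpha h ∈ ZFlow.strictlyErgodicDistalFunctions ∧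
      ZFlow.skewFunction ZFlow.furstenbergAlpha g ∈ ZFlow.strictlyErgodicDistalFunctions ∧
      ZFlow.skewFunction ZFlow.furstenbergAlpha f ∈ ZFlow.distalFunctions ∧
      ZFlow.skewFunction ZFlow.furstenbergAlpha f ∉ ZFlow.strictlyErgodicFunctions ∧
      ZFlow.skewFunction ZFlow.furstenbergAlpha g - ZFlow.skewFunction ZFlow.furstenbergAlpha h ∉
        ZFlow.strictlyErgodicFunctions := by
  obtain ⟨t, ht0, ht1, h, g, f, hh, hg, hf, hfgh, hSh, hSg, hmin, hnue, hEf, hEgh⟩ :=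
    ZFlow.exists_furstenberg_example
  have hEh := ZFlow.skewFunction_mem_strictlyErgodicDistalFunctions hSh
  have hEg := ZFlow.skewFunction_mem_strictlyErgodicDistalFunctions hSg
  refine ⟨⟨_, hEg, _, hEh, hEgh⟩, ?_, ?_, ?_, t, ht0, ht1, h, g, f, hh, hg, hf, hfgh,
    ⟨ZFlow.isDistal_skew h, hSh⟩, ⟨ZFlow.isDistal_skew g, hSg⟩,
    ⟨ZFlow.isDistal_skew f, hmin, hnue⟩, hEh, hEg, ZFlow.skewFunction_mem_distalFunctions hmin,
    hEf, hEgh⟩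
  · rintro ⟨A, hA⟩
    rw [← hA] at hEg hEh
    have h1 : _ ∈ (A : Set ℓ^∞(ℤ, ℂ)) := A.sub_mem hEg hEh
    rw [hA] at h1
    exact hEgh h1.2
  · rintro ⟨V, hV⟩
    rw [← hV] at hEg hEh
    have h1 : _ ∈ (V : Set ℓ^∞(ℤ, ℂ)) := V.sub_mem hEg hEh
    rw [hV] at h1
    exact hEgh h1.2
  -- Were `𝒲` all of `𝒮^d`, it would contain `E_g - E_h`, which would then be strictly ergodic.
  · refine ⟨ZFlow.weylAlgebra_subset_strictlyErgodicDistalFunctions, fun hsub => hEgh ?_⟩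
    exact (ZFlow.weylAlgebra_subset_strictlyErgodicDistalFunctions
      (ZFlow.weylAlgebra.sub_mem (hsub hEg) (hsub hEh))).2
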